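/- **Setting.** Let $N$ be a finite-dimensional smooth manifold (without boundary, Hausdorff, second countable), $C^\infty(N)$ the smooth complex functions on $N$ and, for $U\subseteq N$ open, $\operatorname{Vect}(U)$ the complexified smooth vector fields on $U$. Let $p:H\to N$ be a field of complex Hilbert spaces $\mathcal H(\lambda)=p^{-1}(\lambda)$, and write $h(\varphi,\psi)(\lambda)=\langle\varphi(\lambda),\psi(\lambda)\rangle_\lambda$ for sections $\varphi,\psi$ (antilinear in $\psi$). A *connection* on a space $\Gamma$ of sections is a map $\nabla:\operatorname{Vect}(N)\times\Gamma\to\Gamma$ with $\nabla_{X+Y}=\nabla_X+\nabla_Y$, $\nabla_{aX}=a\nabla_X$, $\nabla_X(a\varphi)=X(a)\varphi+a\nabla_X\varphi$, $h(\varphi,\psi)\in C^\infty(N)$ and $Xh(\varphi,\psi)=h(\nabla_X\varphi,\psi)+h(\varphi,\nabla_{\overline X}\psi)$ for all $X,Y\in\operatorname{Vect}(N)$, $a\in C^\infty(N)$, $\varphi,\psi\in\Gamma$. A *smooth field of Hilbert spaces* $(p:H\to N,\Gamma^\infty,\nabla)$ is such a field with a $C^\infty(N)$-module $\Gamma^\infty$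 of sections and a connection $\nabla$ on $\Gamma^\infty$ such that $\{\varphi(\lambda):\varphi\in\Gamma^\infty\}$ is dense in $\mathcal H(\lambda)$ for every $\lambda\in N$. For $U\subseteq N$ open, $X\in\operatorname{Vect}(U)$ and $\varphi\in\Gamma^\infty$, let $(\nabla_X\varphi)(\lambda):=(\nabla_Y\varphi)(\lambda)$ for $\lambda\in U$, where $Y\in\operatorname{Vect}(N)$ agrees with $X$ near $\lambda$. Let $\Gamma^0(U)$ be the space of sections over $U$ that are locally uniform limits on $U$ of a sequence in $\Gamma^\infty$. Let $\Gamma^1(U)$ be the space of sections $\varphi$ over $U$ for which there is a sequence $(\varphi_j)$ in $\Gamma^\infty$ with $\varphi_j\to\varphi$ locally uniformly on $U$ and $\nabla_X\varphi_j$ locally uniformly convergent on $U$ for every $X\in\operatorname{Vect}(U)$; then $\nabla_X\varphi:=\lim_j\nabla_X\varphi_j$. For $n\ge2$, $\Gamma^n(U)$ consists of the $\varphi\in\Gamma^{n-1}(U)$ with $\nabla_X\varphi\in\Gamma^{n-1}(U)$ for every $X\in\operatorname{Vect}(U)$. Let $\Gamma^\infty(U)=\bigcap_n\Gamma^n(U)$.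 Let $\{U_i\}_{i\in I}$ be an open cover of $N$, $\{\mathcal H_i\}_{i\in I}$ a family of complex Hilbert spaces, and $T_i(\lambda):\mathcal H(\lambda)\to\mathcal H_i$ a unitary operator for each $i\in I$ and $\lambda\in U_i$; for a section $\varphi$ over $U_i$ put $(T_i\varphi)(\lambda)=T_i(\lambda)\varphi(\lambda)$. Given a (smooth, real) Banach manifold structure on $H$, whose charts may take values in different Banach spaces, the family $\{(U_i,\mathcal H_i,T_i)\}$ is a *Hilbert bundle structure* if $p$ is smooth and each map $p^{-1}(U_i)\to U_i\times\mathcal H_i$, $x\mapsto(p(x),T_i(p(x))x)$, is a diffeomorphism. In that case $\Gamma^\infty(U,H|_U)$ denotes the space of smooth sections over the open set $U$, and $\Gamma^\infty(N,H)$ that of smooth sections over $N$. **Theorem 1.1.** Let $(p:H\to N,\Gamma^\infty,\nabla)$ be a smooth field of Hilbert spaces and $\{(U_i,\mathcal H_i,T_i)\}_{i\in I}$ as above. The following are equivalent. (a) There is a Banach manifold structure on $H$ for which $\{(U_i,\mathcal H_i,T_i)\}_{i\in I}$ is a Hilbert bundle structure, such that $\Gamma^\infty(U_i,H|_{U_i})=\Gamma^\infty(U_i)$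 for every $i\in I$, $\Gamma^\infty\subseteq\Gamma^\infty(N,H)$, and there is a connection $\tilde\nabla$ on $\Gamma^\infty(N,H)$ with $\tilde\nabla|_{\Gamma^\infty}=\nabla$. (b) $T_i(\Gamma^\infty(U_i))=C^\infty(U_i,\mathcal H_i)$ for every $i\in I$. If these conditions hold, then $\Gamma^\infty(N)=\Gamma^\infty(N,H)$ for every Banach manifold structure on $H$ for which $\{(U_i,\mathcal H_i,T_i)\}_{i\in I}$ is a Hilbert bundle structure. -/

import Mathlib

open Set Filter TopologicalSpace
open scoped Manifold ContDiff Topology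

universe uE uN uH uI uF v

noncomputable section

/-! ### Complexified vector fields -/

section VectorFields

variable {E : Type uE} [NormedAddCommGroup E] [NormedSpace ℝ E]
  {N : Type uN} [TopologicalSpace N] [ChartedSpace E N] [IsManifold 𝓘(ℝ, E) ∞ N]

/-- A smooth complexified vector field `re + i im` on the open set `U`, that is, an element of
`Vect(U)`. The two real vector fields are stored as functions on `N`; only their values at the
points of `U` are ever used. -/
@[ext]
structure CVect (U : Opens N) where
  re : ∀ x : N, TangentSpace 𝓘(ℝ, E) x
  im : ∀ x : N, TangentSpace 𝓘(ℝ, E) x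
  smooth_re : ContMDiffOn 𝓘(ℝ, E) 𝓘(ℝ, E).tangent ∞
    (fun x => (⟨x, re x⟩ : TangentBundle 𝓘(ℝ, E) N)) (U : Set N)
  smooth_im : ContMDiffOn 𝓘(ℝ, E) 𝓘(ℝ, E).tangent ∞
    (fun x => (⟨x, im x⟩ : TangentBundle 𝓘(ℝ, E) N)) (U : Set N)

/-- Smooth complex valued functions on `N`. -/
abbrev CFun (E : Type uE) [NormedAddCommGroup E] [NormedSpace ℝ E]
    (N : Type uN) [TopologicalSpace N] [ChartedSpace E N] : Type _ :=
  C^∞⟮𝓘(ℝ, E), N; 𝓘(ℝ, ℂ), ℂ⟯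

namespace CVect

/-- The derivative of a complex valued function along a real tangent vector. -/
def realDeriv (a : N → ℂ) (x : N) (w : TangentSpace 𝓘(ℝ, E) x) : ℂ :=
  mfderiv 𝓘(ℝ, E) 𝓘(ℝ, ℂ) a x w

/-- The derivative `X(a)` of a complex valued function along `X` (used only for smooth `a`). -/
def deriv (X : CVect (E := E) (⊤ : Opens N)) (a : N → ℂ) (x : N) : ℂ :=
  realDeriv a x (X.re x) + Complex.I * realDeriv a x (X.im x)

/-- The sum of two complexified vector fields. -/
def add {U : Opens N} (X Y : CVect (E := E) U) : CVect (E := E) U where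
  re := X.re + Y.re
  im := X.im + Y.im
  smooth_re := X.smooth_re.add_section Y.smooth_re
  smooth_im := X.smooth_im.add_section Y.smooth_im

/-- The complex conjugate `re - i im` of a complexified vector field. -/
def conj {U : Opens N} (X : CVect (E := E) U) : CVect (E := E) U where
  re := X.re
  im := -X.im
  smooth_re := X.smooth_re
  smooth_im := X.smooth_im.neg_section

/-- The product `(a₁ + i a₂)(re + i im)` of a smooth complex function and a complexified vector
field. -/
def smul {U : Opens N} (a : CFun E N) (X : CVect (E := E) U) : CVect (E := E) U where
  re := (fun x => (a x).re) • X.re - (fun x => (a x).im) • X.im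
  im := (fun x => (a x).re) • X.im + (fun x => (a x).im) • X.re
  smooth_re := by
    have h1 := (Complex.reCLM.contMDiff (n := ∞)).comp a.contMDiff
    have h2 := (Complex.imCLM.contMDiff (n := ∞)).comp a.contMDiff
    exact (h1.contMDiffOn.smul_section X.smooth_re).sub_section
      (h2.contMDiffOn.smul_section X.smooth_im)
  smooth_im := by
    have h1 := (Complex.reCLM.contMDiff (n := ∞)).comp a.contMDiff
    have h2 := (Complex.imCLM.contMDiff (n := ∞)).comp a.contMDiff
    exact (h1.contMDiffOn.smul_section X.smooth_im).add_section
      (h2.contMDiffOn.smul_section X.smooth_re)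

/-- Every vector field on `U` agrees, near a given point of `U`, with a vector field on the whole
manifold. -/
theorem exists_extend [FiniteDimensional ℝ E] [T2Space N] {U : Opens N}
    (X : CVect (E := E) U) (x : U) :
    ∃ Y : CVect (E := E) (⊤ : Opens N),
      ∀ᶠ y in 𝓝 (x : N), Y.re y = X.re y ∧ Y.im y = X.im y := by
  obtain ⟨f, hf, -⟩ := ((SmoothBumpFunction.nhds_basis_support (I := 𝓘(ℝ, E))
    (U.isOpen.mem_nhds x.2)).mem_iff).1 (U.isOpen.mem_nhds x.2)
  refine ⟨⟨(f : N → ℝ) • X.re, (f : N → ℝ) • X.im, ?_, ?_⟩, ?_⟩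
  · exact (ContMDiffOn.smul_section_of_tsupport f.contMDiff.contMDiffOn U.isOpen hf
      X.smooth_re).contMDiffOn
  · exact (ContMDiffOn.smul_section_of_tsupport f.contMDiff.contMDiffOn U.isOpen hf
      X.smooth_im).contMDiffOn
  · filter_upwards [f.eventuallyEq_one] with y hy
    simp [hy]

/-- A globally defined vector field that agrees with `X` near the point `x` of `U`. -/
def extend [FiniteDimensional ℝ E] [T2Space N] {U : Opens N}
    (X : CVect (E := E) U) (x : U) : CVect (E := E) (⊤ : Opens N) :=
  (X.exists_extend x).choose

end CVect

end VectorFields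

/-! ### Fields of Hilbert spaces, connections and smooth fields -/

section Fields

variable (E : Type uE) [NormedAddCommGroup E] [NormedSpace ℝ E]
  {N : Type uN} [TopologicalSpace N] [ChartedSpace E N] [IsManifold 𝓘(ℝ, E) ∞ N]
  (H : N → Type uH) [∀ x, NormedAddCommGroup (H x)] [∀ x, InnerProductSpace ℂ (H x)]

/-- The function `h(φ,ψ)(x) = ⟨φ(x), ψ(x)⟩`, antilinear in the second variable (Mathlib's inner
product is antilinear in the first one). -/
def herm {N : Type uN} {H : N → Type uH} [∀ x, NormedAddCommGroup (H x)]
    [∀ x, InnerProductSpace ℂ (H x)] (φ ψ : ∀ x, H x) (x : N) : ℂ :=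
  inner ℂ (ψ x) (φ x)

/-- A connection on a set `Γ` of sections of the field `H`: a map `Vect(N) × Γ → Γ` satisfying the
algebraic rules and compatible with the inner products. -/
structure HermConn (Γ : Set (∀ x, H x)) where
  /-- the map `(X, φ) ↦ ∇_X φ` -/
  cov : CVect (E := E) (⊤ : Opens N) → Γ → Γ
  cov_add : ∀ (X Y : CVect (E := E) (⊤ : Opens N)) (φ : Γ) (x : N),
    (cov (X.add Y) φ).1 x = (cov X φ).1 x + (cov Y φ).1 x
  cov_smul : ∀ (a : CFun E N) (X : CVect (E := E) (⊤ : Opens N)) (φ : Γ) (x : N),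
    (cov (X.smul a) φ).1 x = a x • (cov X φ).1 x
  leibniz : ∀ (a : CFun E N) (X : CVect (E := E) (⊤ : Opens N)) (φ : Γ)
    (haφ : (fun x => a x • φ.1 x) ∈ Γ) (x : N),
    (cov X ⟨fun x => a x • φ.1 x, haφ⟩).1 x = X.deriv a x • φ.1 x + a x • (cov X φ).1 x
  herm_smooth : ∀ φ ψ : Γ, ContMDiff 𝓘(ℝ, E) 𝓘(ℝ, ℂ) ∞ (herm φ.1 ψ.1)
  herm_deriv : ∀ (X : CVect (E := E) (⊤ : Opens N)) (φ ψ : Γ) (x : N),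
    X.deriv (herm φ.1 ψ.1) x = herm (cov X φ).1 ψ.1 x + herm φ.1 (cov X.conj ψ).1 x

/-- A smooth structure on the field of Hilbert spaces `H`: a `C^∞(N)`-module of sections with a
connection, whose values are dense in every fibre. -/
structure SmoothField where
  /-- the space of sections `Γ^∞` -/
  Γ : Submodule ℂ (∀ x, H x)
  smul_mem : ∀ (a : CFun E N) (φ : ∀ x, H x), φ ∈ Γ → (fun x => a x • φ x) ∈ Γ
  /-- the connection `∇` -/
  conn : HermConn E H (Γ : Set (∀ x, H x))
  dense : ∀ x, Dense {u : H x | ∃ φ ∈ Γ, φ x = u}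

variable {E H}

/-- Local uniform convergence of a sequence of sections over `U`. -/
def SecTendsto {U : Opens N} (s : ℕ → ∀ x : U, H x) (φ : ∀ x : U, H x) : Prop :=
  TendstoLocallyUniformly (fun j (x : U) => ‖s j x - φ x‖) (fun _ => (0 : ℝ)) atTop

namespace SmoothField

variable [FiniteDimensional ℝ E] [T2Space N] (S : SmoothField E H)

/-- The connection induced on `Γ^∞|_U`: for `X ∈ Vect(U)`, the value of `∇_X φ` at `x ∈ U` is that
of `∇_Y φ` for any `Y ∈ Vect(N)` that agrees with `X` near `x` (see `covOn_eq`). -/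
def covOn (U : Opens N) (X : CVect (E := E) U) (φ : S.Γ) (x : U) : H x :=
  (S.conn.cov (X.extend x) φ).1 x

/-- `covOn` does not depend on the chosen extension of the vector field. -/
theorem covOn_eq (U : Opens N) (X : CVect (E := E) U) (φ : S.Γ) (x : U)
    (Y : CVect (E := E) (⊤ : Opens N))
    (hY : ∀ᶠ y in 𝓝 (x : N), Y.re y = X.re y ∧ Y.im y = X.im y) :
    S.covOn U X φ x = (S.conn.cov Y φ).1 x := by
  have hZ := (X.exists_extend x).choose_spec
  have hYZ : {y : N | Y.re y = (X.extend x).re y ∧ Y.im y = (X.extend x).im y} ∈ 𝓝 (x : N) := by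
    filter_upwards [hY, hZ] with y h1 h2
    exact ⟨h1.1.trans h2.1.symm, h1.2.trans h2.2.symm⟩
  obtain ⟨f, hf, -⟩ := ((SmoothBumpFunction.nhds_basis_support (I := 𝓘(ℝ, E)) hYZ).mem_iff).1 hYZ
  let a : CFun E N := ⟨fun y => ((f y : ℝ) : ℂ),
    (Complex.ofRealCLM.contMDiff (n := ∞)).comp f.contMDiff⟩
  have key : Y.smul a = (X.extend x).smul a := by
    have h : ∀ y, f y • Y.re y = f y • (X.extend x).re y ∧
        f y • Y.im y = f y • (X.extend x).im y := by
      intro y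
      by_cases hy : y ∈ tsupport f
      · exact ⟨by rw [(hf hy).1], by rw [(hf hy).2]⟩
      · simp [image_eq_zero_of_notMem_tsupport hy]
    have ha1 : ∀ y, (a y).re = f y := fun y => rfl
    have ha2 : ∀ y, (a y).im = 0 := fun y => rfl
    apply CVect.ext <;> funext y <;> simp [CVect.smul, ha1, ha2, (h y).1, (h y).2]
  have h1 := S.conn.cov_smul a Y φ x
  have h2 := S.conn.cov_smul a (X.extend x) φ x
  have ha : a (x : N) = 1 := by
    have := f.eventuallyEq_one.eq_of_nhds
    change ((f (x : N) : ℝ) : ℂ) = 1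
    simp
  rw [key, h2, ha, one_smul, one_smul] at h1
  exact h1

/-- The space `Γ^0(U)` of the sections over `U` that are locally uniform limits of a sequence in
`Γ^∞`. -/
def Gamma0 (U : Opens N) : Set (∀ x : U, H x) :=
  {φ | ∃ s : ℕ → S.Γ, SecTendsto (fun j (x : U) => (s j).1 x) φ}

/-- `φ` belongs to `Γ^1(U)` and `D X = ∇_X φ` for every `X ∈ Vect(U)`: some sequence in `Γ^∞`
converges to `φ` locally uniformly on `U`, while its covariant derivatives along each `X ∈ Vect(U)`
converge locally uniformly to `D X`. -/
def HasCov (U : Opens N) (φ : ∀ x : U, H x) (D : CVect (E := E) U → ∀ x : U, H x) : Prop :=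
  ∃ s : ℕ → S.Γ, SecTendsto (fun j (x : U) => (s j).1 x) φ ∧
    ∀ X : CVect (E := E) U, SecTendsto (fun j => S.covOn U X (s j)) (D X)

/-- The space `Γ^n(U)` of `n` times differentiable sections over `U`. -/
def GammaN (U : Opens N) : ℕ → Set (∀ x : U, H x)
  | 0 => S.Gamma0 U
  | 1 => {φ | ∃ D, S.HasCov U φ D}
  | n + 2 => {φ | φ ∈ GammaN U (n + 1) ∧ ∃ D, S.HasCov U φ D ∧ ∀ X, D X ∈ GammaN U (n + 1)}

/-- The space `Γ^∞(U) = ⋂ₙ Γ^n(U)`. -/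
def GammaInf (U : Opens N) : Set (∀ x : U, H x) := ⋂ n, S.GammaN U n

/-- The space `Γ^∞(N)`. -/
def GammaInfGlobal : Set (∀ x, H x) :=
  {φ | (fun x : (⊤ : Opens N) => φ x) ∈ S.GammaInf ⊤}

end SmoothField

end Fields

/-! ### Banach manifolds

The charts are allowed to take values in different Banach spaces, as they must when the fibre
dimension is not the same on all components of the base. -/

section BanachManifolds

/-- A chart of the topological space `M` with values in an open subset of a real Banach space. -/
structure BanachChart (M : Type uN) [TopologicalSpace M] where
  V : Type v
  [normed : NormedAddCommGroup V]
  [space : NormedSpace ℝ V]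
  [complete : CompleteSpace V]
  chart : OpenPartialHomeomorph M V

attribute [instance] BanachChart.normed BanachChart.space BanachChart.complete

/-- A (smooth, real) Banach manifold structure on the set `M`: a topology and a smooth atlas. -/
structure BanachManifold (M : Type uN) where
  [top : TopologicalSpace M]
  atlas : Set (BanachChart.{uN, v} M)
  cover : ∀ m : M, ∃ c ∈ atlas, m ∈ c.chart.source
  compat : ∀ c ∈ atlas, ∀ c' ∈ atlas,
    ContDiffOn ℝ ∞ (c.chart.symm.trans c'.chart) (c.chart.symm.trans c'.chart).source

namespace BanachManifold

variable {M : Type uN} (B : BanachManifold.{uN, v} M)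
  {F : Type*} [NormedAddCommGroup F] [NormedSpace ℝ F]
  {K : Type*} [TopologicalSpace K] {J : ModelWithCorners ℝ F K}
  {P : Type*} [TopologicalSpace P] [ChartedSpace K P]

/-- Smoothness of a map `f` from a subset `W` of the Banach manifold `M`, open in all uses, to a
manifold `P`: in every chart, over every open set which the chart parametrizes into `W`, the map is
smooth. -/
def SmoothFrom (J : ModelWithCorners ℝ F K) (W : Set M) (f : W → P) : Prop :=
  letI := B.top
  ∀ c ∈ B.atlas, ∀ (O : Opens c.V) (hO : ∀ z ∈ O, z ∈ c.chart.target ∧ c.chart.symm z ∈ W),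
    ContMDiff 𝓘(ℝ, c.V) J ∞ (fun z : O => f ⟨c.chart.symm z.1, (hO z.1 z.2).2⟩)

/-- Smoothness of a map `g` from a manifold `P` to the Banach manifold `M`: the map is continuous
and is smooth in every chart of `M`. -/
def SmoothInto (J : ModelWithCorners ℝ F K) (g : P → M) : Prop :=
  letI := B.top
  Continuous g ∧ ∀ c ∈ B.atlas, ContMDiffOn J 𝓘(ℝ, c.V) ∞ (fun y => c.chart (g y)) (g ⁻¹' c.chart.source)

end BanachManifold

end BanachManifolds

/-! ### Hilbert bundles -/

section HilbertBundles

/-- The total space of a field of Hilbert spaces, without any topology. -/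
structure TotalField {N : Type uN} (H : N → Type uH) where
  /-- the projection -/
  base : N
  /-- the vector in the fibre -/
  vec : H base

variable {E : Type uE} [NormedAddCommGroup E] [NormedSpace ℝ E]
  {N : Type uN} [TopologicalSpace N] [ChartedSpace E N] [IsManifold 𝓘(ℝ, E) ∞ N]
  {H : N → Type uH} [∀ x, NormedAddCommGroup (H x)] [∀ x, InnerProductSpace ℂ (H x)]
  {ι : Type uI} {F : ι → Type uF} [∀ i, NormedAddCommGroup (F i)]
  [∀ i, InnerProductSpace ℂ (F i)]

/-- The local trivialization `p⁻¹(U_i) → U_i × ℋ_i`, `m ↦ (p(m), T_i(p(m)) m)`. -/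
def trivMap (U : ι → Opens N) (T : ∀ i, ∀ x : U i, H x ≃ₗᵢ[ℂ] F i) (i : ι)
    (m : {m : TotalField H | m.base ∈ U i}) : U i × F i :=
  (⟨m.1.base, m.2⟩, T i ⟨m.1.base, m.2⟩ m.1.vec)

/-- The inverse `(x, y) ↦ T_i(x)⁻¹ y` of the local trivialization, as a map into the total space. -/
def trivInv (U : ι → Opens N) (T : ∀ i, ∀ x : U i, H x ≃ₗᵢ[ℂ] F i) (i : ι)
    (q : U i × F i) : TotalField H :=
  ⟨q.1, (T i q.1).symm q.2⟩

/-- With the Banach manifold structure `B` on the total space, the family `(U_i, ℋ_i, T_i)` is a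
Hilbert bundle structure on the field `H`: the projection is smooth, and each local trivialization
(a bijection with inverse `trivInv`) is a diffeomorphism. -/
structure IsHilbertBundle (E : Type uE) [NormedAddCommGroup E] [NormedSpace ℝ E]
    {N : Type uN} [TopologicalSpace N] [ChartedSpace E N]
    {H : N → Type uH} [∀ x, NormedAddCommGroup (H x)] [∀ x, InnerProductSpace ℂ (H x)]
    {ι : Type uI} {F : ι → Type uF} [∀ i, NormedAddCommGroup (F i)]
    [∀ i, InnerProductSpace ℂ (F i)]
    (B : BanachManifold.{max uN uH, v} (TotalField H))
    (U : ι → Opens N) (T : ∀ i, ∀ x : U i, H x ≃ₗᵢ[ℂ] F i) : Prop where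
  continuous_proj : letI := B.top; Continuous (TotalField.base : TotalField H → N)
  smooth_proj : B.SmoothFrom 𝓘(ℝ, E) univ (fun m => m.1.base)
  smooth_triv : ∀ i, B.SmoothFrom (𝓘(ℝ, E).prod 𝓘(ℝ, F i)) {m : TotalField H | m.base ∈ U i}
    (trivMap U T i)
  smooth_inv : ∀ i, B.SmoothInto (𝓘(ℝ, E).prod 𝓘(ℝ, F i)) (trivInv U T i)

/-- The space `Γ^∞(U, H|_U)` of the smooth sections of a Hilbert bundle over `U`. -/
def smoothSec (E : Type uE) [NormedAddCommGroup E] [NormedSpace ℝ E]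
    {N : Type uN} [TopologicalSpace N] [ChartedSpace E N] {H : N → Type uH}
    (B : BanachManifold.{max uN uH, v} (TotalField H)) (U : Opens N) : Set (∀ x : U, H x) :=
  {φ | B.SmoothInto 𝓘(ℝ, E) (fun x : U => (⟨x, φ x⟩ : TotalField H))}

/-- The space `Γ^∞(N, H)` of the smooth global sections of a Hilbert bundle. -/
def smoothSecGlobal (E : Type uE) [NormedAddCommGroup E] [NormedSpace ℝ E]
    {N : Type uN} [TopologicalSpace N] [ChartedSpace E N] {H : N → Type uH}
    (B : BanachManifold.{max uN uH, v} (TotalField H)) : Set (∀ x, H x) :=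
  {φ | B.SmoothInto 𝓘(ℝ, E) (fun x : N => (⟨x, φ x⟩ : TotalField H))}

end HilbertBundles

end

/-! The common yardstick is the condition that `T i` carries a section to a smooth function on `U
i`. For any Hilbert bundle structure it describes the smooth sections
(`IsHilbertBundle.mem_smoothSec_iff`, and `IsHilbertBundle.mem_smoothSecGlobal_iff` for global
ones); under (b) it describes `Γ^∞(U i)`. This gives (b) from (a). It also gives the final equality,
once being infinitely differentiable is known to be a local property of a section
(`DiffOn.of_local`).

Locality rests on uniqueness of covariant derivatives. The identity `X h(φ,ψ) = h(∇_X φ, ψ) + h(φ,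
∇_{X̄} ψ)` survives limits, because uniform convergence of derivatives lets differentiation and
limit be exchanged (`CVect.deriv_of_tendsto`). For `ψ` in `Γ^∞` it determines `∇_X φ` on a dense
subset of the fibre, so `∇_X φ` depends only on the germ of `φ` (`HermDeriv.unique`). Local
approximating sequences are then glued with smooth cut-offs (`IsCov.glue`).

For (a) from (b), constant functions `v` give sections `T i ⁻¹ v` in `Γ^∞(U i)`. By locality, after
a cut-off, they are in `Γ^∞(U j)`, so each `T j T i ⁻¹ v` is smooth. The uniform boundedness
principle, applied to Taylor remainders, upgrades this strong smoothness to smoothness in operator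
norm, as the base is finite-dimensional (`contDiffOn_of_strongly`). Hence the trivializations glue
to a Banach manifold (`bundleManifold`). The functions `h(φ,ψ)` are smooth because the `T i` are
unitary, and the extended connection is the limit connection (`exists_hermConn`). -/

noncomputable section

/-! ### Differentiating limits of functions along vector fields -/

section DerivLimit

variable {E : Type uE} [NormedAddCommGroup E] [NormedSpace ℝ E]
  {N : Type uN} [TopologicalSpace N] [ChartedSpace E N] [IsManifold 𝓘(ℝ, E) ∞ N]

/-- Uniform convergence of continuous linear maps on a finite-dimensional space can be checked on
a basis. -/
theorem exists_tendstoUniformlyOnFilter_of_basis {κ α Z : Type*} [Fintype κ]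
    [FiniteDimensional ℝ E] (b : Module.Basis κ ℝ E) (L : α → Z → (E →L[ℝ] ℂ)) (c : κ → Z → ℂ)
    (l : Filter α) (l' : Filter Z) :
    ∃ g' : Z → (E →L[ℝ] ℂ),
      (∀ k, Tendsto (fun p : α × Z => L p.1 p.2 (b k) - c k p.2) (l ×ˢ l') (𝓝 0)) →
      TendstoUniformlyOnFilter L g' l l' := by
  refine ⟨fun z => (b.constr ℝ (fun k => c k z)).toContinuousLinearMap, fun h => ?_⟩
  -- On a finite-dimensional space the operator norm is at most `C` times any bound for the values
  -- on the basis.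
  obtain ⟨C, -, hC⟩ := b.exists_opNorm_le (F := ℂ) (𝕜 := ℝ)
  rw [tendstoUniformlyOnFilter_iff_tendsto, tendsto_uniformity_iff_dist_tendsto_zero]
  have h1 : Tendsto (fun p : α × Z => C * ∑ k, ‖L p.1 p.2 (b k) - c k p.2‖) (l ×ˢ l') (𝓝 0) := by
    have := (tendsto_finsetSum Finset.univ fun k _ => (h k).norm).const_mul C
    simpa using this
  refine squeeze_zero (fun _ => dist_nonneg) (fun p => ?_) h1
  rw [dist_comm, dist_eq_norm]
  refine hC (Finset.sum_nonneg fun _ _ => norm_nonneg _) fun k => ?_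
  have : (L p.1 p.2 - (b.constr ℝ (fun k => c k p.2)).toContinuousLinearMap) (b k) =
      L p.1 p.2 (b k) - c k p.2 := by
    rw [sub_apply, LinearMap.coe_toContinuousLinearMap',
      Module.Basis.constr_basis]
  rw [this]
  exact Finset.single_le_sum (f := fun k => ‖L p.1 p.2 (b k) - c k p.2‖)
    (fun _ _ => norm_nonneg _) (Finset.mem_univ k)

namespace CVect

/-- Near a given point, the coordinate vector fields of a chart extend to the whole manifold. -/
theorem exists_coordinate_field [FiniteDimensional ℝ E] [T2Space N] (x₀ : N) (v : E) :
    ∃ X : CVect (E := E) (⊤ : Opens N), (∀ᶠ y in 𝓝 x₀, X.im y = 0 ∧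
      X.re y = mfderiv 𝓘(ℝ, E) 𝓘(ℝ, E) (extChartAt 𝓘(ℝ, E) x₀).symm
        (extChartAt 𝓘(ℝ, E) x₀ y) v) := by
  classical
  let e := trivializationAt E (TangentSpace 𝓘(ℝ, E) : N → Type _) x₀
  let W : Opens N := ⟨e.baseSet, e.open_baseSet⟩
  have hsm : ContMDiffOn 𝓘(ℝ, E) 𝓘(ℝ, E).tangent ∞
      (fun x => (⟨x, e.symmL ℝ x v⟩ : TangentBundle 𝓘(ℝ, E) N)) (W : Set N) := by
    have : ContMDiffOn 𝓘(ℝ, E) 𝓘(ℝ, E).tangent ∞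
      (fun x => (Bundle.TotalSpace.mk' E x (e.symmL ℝ x v))) e.baseSet := by
      rw [e.contMDiffOn_section_baseSet_iff]
      apply (contMDiffOn_const (c := v)).congr
      intro y hy
      simp [hy]
    exact this
  let X₀ : CVect (E := E) W :=
    { re := fun x => e.symmL ℝ x v
      im := fun x => 0
      smooth_re := hsm
      smooth_im := by
        have := hsm.sub_section hsm
        simpa using this }
  have hx : x₀ ∈ W := FiberBundle.mem_baseSet_trivializationAt E _ x₀
  obtain ⟨Y, hY⟩ := X₀.exists_extend ⟨x₀, hx⟩
  refine ⟨Y, ?_⟩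
  filter_upwards [hY, (chartAt E x₀).open_source.mem_nhds (mem_chart_source E x₀)] with y hy hy'
  refine ⟨hy.2, hy.1.trans ?_⟩
  have := TangentBundle.symmL_trivializationAt (I := 𝓘(ℝ, E)) (x₀ := x₀) (x := y) hy'
  simp only [modelWithCornersSelf_coe, range_id, mfderivWithin_univ] at this
  exact congrArg (fun L : E →L[ℝ] E => L v) this

theorem deriv_of_im_eq_zero (X : CVect (E := E) (⊤ : Opens N)) (a : N → ℂ) (x : N)
    (h : X.im x = 0) : X.deriv a x = realDeriv a x (X.re x) := by
  have h0 : realDeriv a x (X.im x) = (0 : ℂ) := by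
    rw [h]
    exact map_zero (mfderiv 𝓘(ℝ, E) 𝓘(ℝ, ℂ) a x)
  rw [deriv, h0, mul_zero, add_zero]

/-- The derivative along a vector field of a limit of functions is the limit of the derivatives,
if the derivatives along all vector fields converge locally uniformly. -/
theorem deriv_of_tendsto [FiniteDimensional ℝ E] [T2Space N] {f : ℕ → N → ℂ} {F : N → ℂ}
    {g : CVect (E := E) (⊤ : Opens N) → N → ℂ} {x : N}
    (hd : ∀ᶠ y in 𝓝 x, ∀ j, MDifferentiableAt 𝓘(ℝ, E) 𝓘(ℝ, ℂ) (f j) y)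
    (hf : ∀ᶠ y in 𝓝 x, Tendsto (fun j => f j y) atTop (𝓝 (F y)))
    (hg : ∀ X, Tendsto (fun p : ℕ × N => X.deriv (f p.1) p.2 - g X p.2)
      (atTop ×ˢ 𝓝 x) (𝓝 0)) :
    MDifferentiableAt 𝓘(ℝ, E) 𝓘(ℝ, ℂ) F x ∧ ∀ X, X.deriv F x = g X x := by
  let e := extChartAt 𝓘(ℝ, E) x
  have hex : e.symm (e x) = x := extChartAt_to_inv x
  have hsrc : ∀ᶠ y in 𝓝 x, y ∈ e.source := extChartAt_source_mem_nhds x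
  have htgt : ∀ᶠ z in 𝓝 (e x), z ∈ e.target := extChartAt_target_mem_nhds x
  have hsymm : Tendsto e.symm (𝓝 (e x)) (𝓝 x) := by
    have := continuousAt_extChartAt_symm (I := 𝓘(ℝ, E)) x
    rw [ContinuousAt] at this
    rwa [extChartAt_to_inv x] at this
  have hmsymm : ∀ z ∈ e.target, MDifferentiableAt 𝓘(ℝ, E) 𝓘(ℝ, E) e.symm z := by
    intro z hz
    have := mdifferentiableWithinAt_extChartAt_symm (I := 𝓘(ℝ, E)) hz
    rwa [modelWithCornersSelf_coe, range_id, mdifferentiableWithinAt_univ] at this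
  have hme : MDifferentiableAt 𝓘(ℝ, E) 𝓘(ℝ, E) e x :=
    mdifferentiableAt_extChartAt (mem_chart_source E x)
  have chain : ∀ (φ : N → ℂ) (z : E), z ∈ e.target →
      MDifferentiableAt 𝓘(ℝ, E) 𝓘(ℝ, ℂ) φ (e.symm z) →
      DifferentiableAt ℝ (φ ∘ e.symm) z ∧ ∀ v, fderiv ℝ (φ ∘ e.symm) z v =
        realDeriv φ (e.symm z) (mfderiv 𝓘(ℝ, E) 𝓘(ℝ, E) e.symm z v) := by
    intro φ z hz hφ
    refine ⟨(hφ.comp z (hmsymm z hz)).differentiableAt, fun v => ?_⟩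
    rw [← mfderiv_eq_fderiv, mfderiv_comp z hφ (hmsymm z hz)]
    rfl
  let b := Module.finBasis ℝ E
  -- In the chart, the derivative along `Y k` is the partial derivative along `b k`; so convergence
  -- along vector fields becomes uniform convergence of Fréchet derivatives.
  choose Y hY using fun k => exists_coordinate_field (N := N) x (b k)
  obtain ⟨g', hunif_of⟩ := exists_tendstoUniformlyOnFilter_of_basis b
    (fun (j : ℕ) z => fderiv ℝ (f j ∘ e.symm) z) (fun k z => g (Y k) (e.symm z)) atTop (𝓝 (e x))
  have hchar : ∀ᶠ z in 𝓝 (e x), ∀ j k, fderiv ℝ (f j ∘ e.symm) z (b k) =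
      (Y k).deriv (f j) (e.symm z) := by
    have h1 : ∀ᶠ z in 𝓝 (e x), ∀ k, (Y k).im (e.symm z) = 0 ∧
      (Y k).re (e.symm z) = mfderiv 𝓘(ℝ, E) 𝓘(ℝ, E) e.symm (e (e.symm z)) (b k) :=
      eventually_all.2 fun k => hsymm.eventually (hY k)
    filter_upwards [h1, htgt, hsymm.eventually hd] with z hz hzt hzd j k
    rw [(chain (f j) z hzt (hzd j)).2, deriv_of_im_eq_zero _ _ _ (hz k).1, (hz k).2]
    have hr : e (e.symm z) = z := e.right_inv hzt
    rw [hr]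
  have hunif : TendstoUniformlyOnFilter (fun j z => fderiv ℝ (f j ∘ e.symm) z) g' atTop
      (𝓝 (e x)) := by
    refine hunif_of fun k => ((hg (Y k)).comp (tendsto_id.prodMap hsymm)).congr' ?_
    filter_upwards [tendsto_snd.eventually hchar] with p hp
    simp only [Function.comp_apply, Prod.map_fst, Prod.map_snd, id_eq, hp]
  have hF : HasFDerivAt (F ∘ e.symm) (g' (e x)) (e x) := by
    refine hasFDerivAt_of_tendstoUniformlyOnFilter hunif ?_ (hsymm.eventually hf)
    filter_upwards [tendsto_snd.eventually (htgt.and (hsymm.eventually hd))] with p hp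
    exact (chain _ _ hp.1 (hp.2 p.1)).1.hasFDerivAt
  have hpt : Tendsto (fun j => fderiv ℝ (f j ∘ e.symm) (e x)) atTop (𝓝 (g' (e x))) :=
    hunif.tendsto_at ((principal_singleton (e x)).trans_le (pure_le_nhds _))
  have comp : ∀ φ : N → ℂ, DifferentiableAt ℝ (φ ∘ e.symm) (e x) →
      MDifferentiableAt 𝓘(ℝ, E) 𝓘(ℝ, ℂ) φ x ∧ ∀ w, realDeriv φ x w =
        fderiv ℝ (φ ∘ e.symm) (e x) (mfderiv 𝓘(ℝ, E) 𝓘(ℝ, E) e x w) := by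
    intro φ hφ
    have heq : φ =ᶠ[𝓝 x] (φ ∘ e.symm) ∘ e := by
      filter_upwards [hsrc] with y hy
      simp [e.left_inv hy]
    refine ⟨(hφ.mdifferentiableAt.comp x hme).congr_of_eventuallyEq heq, fun w => ?_⟩
    rw [realDeriv, heq.mfderiv_eq, mfderiv_comp x hφ.mdifferentiableAt hme, mfderiv_eq_fderiv]
    rfl
  have hFx := comp F hF.differentiableAt
  refine ⟨hFx.1, fun X => ?_⟩
  -- For arbitrary `X`, the numbers `X.deriv (f j) x` converge to `X.deriv F x` by the chart
  -- computation and to `g X x` by hypothesis.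
  have hreal : ∀ w : TangentSpace 𝓘(ℝ, E) x,
      Tendsto (fun j => realDeriv (f j) x w) atTop (𝓝 (realDeriv F x w)) := by
    intro w
    have h2 : ∀ u : E, Tendsto (fun j => fderiv ℝ (f j ∘ e.symm) (e x) u) atTop
        (𝓝 (g' (e x) u)) := fun u =>
      ((ContinuousLinearMap.apply ℝ ℂ u).continuous.tendsto _).comp hpt
    have h3 : realDeriv F x w = g' (e x) (mfderiv 𝓘(ℝ, E) 𝓘(ℝ, E) e x w) := by
      rw [hFx.2, hF.fderiv]
    rw [h3]
    refine (h2 _).congr fun j => ((comp (f j) ?_).2 w).symm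
    refine (chain (f j) (e x) (mem_extChartAt_target x) ?_).1
    rw [hex]
    exact hd.self_of_nhds j
  have h1 : Tendsto (fun j => X.deriv (f j) x) atTop (𝓝 (X.deriv F x)) :=
    (hreal (X.re x)).add ((hreal (X.im x)).const_mul Complex.I)
  have h2 : Tendsto (fun j => X.deriv (f j) x) atTop (𝓝 (g X x)) := by
    have h3 : Tendsto (fun j : ℕ => (j, x)) atTop (atTop ×ˢ 𝓝 x) :=
      tendsto_id.prodMk tendsto_const_nhds
    have h4 := (hg X).comp h3
    rw [← tendsto_sub_nhds_zero_iff]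
    exact h4
  exact tendsto_nhds_unique h1 h2

end CVect

end DerivLimit

/-! ### Calculus of complexified vector fields -/

section VectorFieldCalculus

variable {E : Type uE} [NormedAddCommGroup E] [NormedSpace ℝ E]
  {N : Type uN} [TopologicalSpace N] [ChartedSpace E N] [IsManifold 𝓘(ℝ, E) ∞ N]

namespace CVect

theorem conj_conj {U : Opens N} (X : CVect (E := E) U) : X.conj.conj = X := by
  apply CVect.ext
  · rfl
  · exact neg_neg X.im

theorem deriv_congr (X : CVect (E := E) (⊤ : Opens N)) {f g : N → ℂ} {x : N}
    (h : f =ᶠ[𝓝 x] g) : X.deriv f x = X.deriv g x := by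
  have key : ∀ w : TangentSpace 𝓘(ℝ, E) x, realDeriv f x w = realDeriv g x w := fun w => by
    rw [realDeriv, h.mfderiv_eq]
    rfl
  rw [deriv, deriv, key, key]

theorem deriv_const (X : CVect (E := E) (⊤ : Opens N)) (c : ℂ) (x : N) :
    X.deriv (fun _ => c) x = 0 := by
  have key : ∀ w : TangentSpace 𝓘(ℝ, E) x, realDeriv (fun _ : N => c) x w = 0 := fun w => by
    rw [realDeriv, mfderiv_const]
    rfl
  rw [deriv, key, key, mul_zero, add_zero]

theorem deriv_add_fun (X : CVect (E := E) (⊤ : Opens N)) {f g : N → ℂ} {x : N}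
    (hf : MDifferentiableAt 𝓘(ℝ, E) 𝓘(ℝ, ℂ) f x) (hg : MDifferentiableAt 𝓘(ℝ, E) 𝓘(ℝ, ℂ) g x) :
    X.deriv (fun y => f y + g y) x = X.deriv f x + X.deriv g x := by
  have key : ∀ w : TangentSpace 𝓘(ℝ, E) x, realDeriv (fun y => f y + g y) x w =
      realDeriv f x w + realDeriv g x w := fun w => by
    have := (hf.hasMFDerivAt.add hg.hasMFDerivAt).mfderiv
    exact congrArg (fun L : E →L[ℝ] ℂ => L w) this
  rw [deriv, deriv, deriv, key, key]
  ring

theorem deriv_sum {κ : Type*} (X : CVect (E := E) (⊤ : Opens N)) (s : Finset κ) {f : κ → N → ℂ}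
    {x : N} (hf : ∀ k ∈ s, MDifferentiableAt 𝓘(ℝ, E) 𝓘(ℝ, ℂ) (f k) x) :
    MDifferentiableAt 𝓘(ℝ, E) 𝓘(ℝ, ℂ) (fun y => ∑ k ∈ s, f k y) x ∧
      X.deriv (fun y => ∑ k ∈ s, f k y) x = ∑ k ∈ s, X.deriv (f k) x := by
  classical
  induction s using Finset.induction_on with
  | empty => simpa using ⟨mdifferentiableAt_const, X.deriv_const 0 x⟩
  | insert k s hk ih =>
    have h1 := hf k (Finset.mem_insert_self k s)
    have h2 := ih fun l hl => hf l (Finset.mem_insert_of_mem hl)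
    simp only [Finset.sum_insert hk]
    exact ⟨h1.add h2.1, by rw [X.deriv_add_fun h1 h2.1, h2.2]⟩

omit [IsManifold 𝓘(ℝ, E) ∞ N] in
theorem _root_.HasMFDerivAt.star_complex {f : N → ℂ} {x : N} {f' : E →L[ℝ] ℂ}
    (hf : HasMFDerivAt 𝓘(ℝ, E) 𝓘(ℝ, ℂ) f x f') :
    HasMFDerivAt 𝓘(ℝ, E) 𝓘(ℝ, ℂ) (fun y => star (f y)) x
      ((Complex.conjCLE : ℂ →L[ℝ] ℂ).comp f') := by
  have h0 : HasMFDerivAt 𝓘(ℝ, ℂ) 𝓘(ℝ, ℂ) (fun z : ℂ => star z) (f x)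
      (Complex.conjCLE : ℂ →L[ℝ] ℂ) :=
    (Complex.conjCLE : ℂ →L[ℝ] ℂ).hasMFDerivAt
  exact h0.comp x hf

theorem deriv_star (X : CVect (E := E) (⊤ : Opens N)) {f : N → ℂ} {x : N}
    (hf : MDifferentiableAt 𝓘(ℝ, E) 𝓘(ℝ, ℂ) f x) :
    X.deriv (fun y => star (f y)) x = star (X.conj.deriv f x) := by
  have h1 := HasMFDerivAt.star_complex hf.hasMFDerivAt
  have key : ∀ w : TangentSpace 𝓘(ℝ, E) x, realDeriv (fun y => star (f y)) x w =
      star (realDeriv f x w) := fun w =>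
    congrArg (fun L : E →L[ℝ] ℂ => L w) h1.mfderiv
  have h2 : realDeriv f x (X.conj.im x) = -realDeriv f x (X.im x) :=
    map_neg (mfderiv 𝓘(ℝ, E) 𝓘(ℝ, ℂ) f x) _
  have h3 : X.conj.re = X.re := rfl
  rw [deriv, deriv, key, key, h2, h3]
  simp

/-- The tangent map of `a` after the section `V` is a smooth map into the tangent bundle of `ℂ`,
which is trivial; the derivative is its fibre component. -/
theorem contMDiff_realDeriv {a : N → ℂ} (ha : ContMDiff 𝓘(ℝ, E) 𝓘(ℝ, ℂ) ∞ a)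
    {V : ∀ x : N, TangentSpace 𝓘(ℝ, E) x}
    (hV : ContMDiff 𝓘(ℝ, E) 𝓘(ℝ, E).tangent ∞ (fun x => (⟨x, V x⟩ : TangentBundle 𝓘(ℝ, E) N))) :
    ContMDiff 𝓘(ℝ, E) 𝓘(ℝ, ℂ) ∞ (fun x => realDeriv a x (V x)) := by
  have h1 : ContMDiff 𝓘(ℝ, E).tangent 𝓘(ℝ, ℂ).tangent ∞ (tangentMap 𝓘(ℝ, E) 𝓘(ℝ, ℂ) a) :=
    ha.contMDiff_tangentMap (by simp)
  have h2 := h1.comp hV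
  intro x
  have h3 := ((Bundle.contMDiffAt_totalSpace (IB := 𝓘(ℝ, ℂ)) (F := ℂ) (n := ∞)).1 (h2 x)).2
  refine h3.congr_of_eventuallyEq (Eventually.of_forall fun y => ?_)
  exact (congrArg Prod.snd (trivializationAt_model_space_apply (I := 𝓘(ℝ, ℂ))
    ((tangentMap 𝓘(ℝ, E) 𝓘(ℝ, ℂ) a ∘ fun x => ⟨x, V x⟩) y) (a x))).symm

/-- The derivative of a smooth function along a vector field, as a smooth function. -/
def derivFun (X : CVect (E := E) (⊤ : Opens N)) (a : CFun E N) : CFun E N :=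
  ⟨X.deriv a, by
    have h1 := contMDiff_realDeriv a.contMDiff (contMDiffOn_univ.1 X.smooth_re)
    have h2 := contMDiff_realDeriv a.contMDiff (contMDiffOn_univ.1 X.smooth_im)
    exact h1.add ((contDiff_const.mul contDiff_id).comp_contMDiff h2)⟩

end CVect

omit [IsManifold 𝓘(ℝ, E) ∞ N] in
theorem CFun.mdifferentiableAt (a : CFun E N) (x : N) :
    MDifferentiableAt 𝓘(ℝ, E) 𝓘(ℝ, ℂ) a x :=
  a.contMDiff.mdifferentiableAt (by simp)

end VectorFieldCalculus

/-! ### Locally uniform convergence of sections -/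

section LocalConvergence

variable {N : Type uN} [TopologicalSpace N] {H : N → Type uH} [∀ x, NormedAddCommGroup (H x)]

/-- Locally uniform convergence at the point `x` of a sequence of sections. -/
def LTendsto (s : ℕ → ∀ x, H x) (φ : ∀ x, H x) (x : N) : Prop :=
  Tendsto (fun p : ℕ × N => ‖s p.1 p.2 - φ p.2‖) (atTop ×ˢ 𝓝 x) (𝓝 0)

/-- Local boundedness of a section at the point `x`. -/
def LBounded (φ : ∀ x, H x) (x : N) : Prop :=
  ∃ C, ∀ᶠ y in 𝓝 x, ‖φ y‖ ≤ C

namespace LTendsto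

variable {s t : ℕ → ∀ x, H x} {φ ψ : ∀ x, H x} {x : N}

theorem congr' (h : LTendsto s φ x) (hs : ∀ᶠ p : ℕ × N in atTop ×ˢ 𝓝 x, s p.1 p.2 = t p.1 p.2)
    (hφ : ∀ᶠ y in 𝓝 x, φ y = ψ y) : LTendsto t ψ x := by
  refine Tendsto.congr' ?_ h
  filter_upwards [hs, tendsto_snd.eventually hφ] with p h1 h2
  rw [h1, h2]

theorem congr (h : LTendsto s φ x) (hs : ∀ᶠ y in 𝓝 x, ∀ j, s j y = t j y)
    (hφ : ∀ᶠ y in 𝓝 x, φ y = ψ y) : LTendsto t ψ x :=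
  h.congr' ((tendsto_snd.eventually hs).mono fun p hp => hp p.1) hφ

theorem refl (φ : ∀ x, H x) (x : N) : LTendsto (fun _ => φ) φ x := by
  simp [LTendsto]

theorem add (h : LTendsto s φ x) (h' : LTendsto t ψ x) :
    LTendsto (fun j y => s j y + t j y) (fun y => φ y + ψ y) x := by
  have := Tendsto.add h h'
  rw [add_zero] at this
  refine squeeze_zero (fun _ => norm_nonneg _) (fun p => ?_) this
  rw [add_sub_add_comm]
  exact norm_add_le _ _

theorem sum {κ : Type*} {u : κ → ℕ → ∀ x, H x} {χ : κ → ∀ x, H x} (F : Finset κ)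
    (h : ∀ k ∈ F, LTendsto (u k) (χ k) x) :
    LTendsto (fun j y => ∑ k ∈ F, u k j y) (fun y => ∑ k ∈ F, χ k y) x := by
  classical
  induction F using Finset.induction_on with
  | empty => simpa using refl (fun y => (0 : H y)) x
  | insert k F hk ih =>
    simp only [Finset.sum_insert hk]
    exact (h k (Finset.mem_insert_self k F)).add
      (ih fun l hl => h l (Finset.mem_insert_of_mem hl))

theorem smul [∀ x, NormedSpace ℂ (H x)] {a : N → ℂ} (ha : ContinuousAt a x)
    (h : LTendsto s φ x) :
    LTendsto (fun j y => a y • s j y) (fun y => a y • φ y) x := by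
  have h1 : Tendsto (fun p : ℕ × N => ‖a p.2‖) (atTop ×ˢ 𝓝 x) (𝓝 ‖a x‖) :=
    (ha.tendsto.comp tendsto_snd).norm
  have h2 := h1.mul h
  rw [mul_zero] at h2
  refine h2.congr fun p => ?_
  rw [← smul_sub, norm_smul]

theorem tendsto_norm (h : LTendsto s φ x) :
    Tendsto (fun j => ‖s j x - φ x‖) atTop (𝓝 0) :=
  Tendsto.comp (g := fun p : ℕ × N => ‖s p.1 p.2 - φ p.2‖) h
    (tendsto_id.prodMk tendsto_const_nhds : Tendsto (fun j : ℕ => (j, x)) _ (atTop ×ˢ 𝓝 x))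

theorem tendsto (h : LTendsto s φ x) : Tendsto (fun j => s j x) atTop (𝓝 (φ x)) :=
  tendsto_iff_norm_sub_tendsto_zero.2 h.tendsto_norm

/-- A single `s j` is within distance 1 of `φ` on a whole neighbourhood of `x`, so its bound passes
to `φ`. -/
theorem lbounded (h : LTendsto s φ x) (hs : ∀ j, LBounded (s j) x) : LBounded φ x := by
  have h1 : ∀ᶠ p : ℕ × N in atTop ×ˢ 𝓝 x, ‖s p.1 p.2 - φ p.2‖ < 1 :=
    h.eventually (gt_mem_nhds one_pos)
  obtain ⟨j, hj⟩ := h1.curry.exists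
  obtain ⟨C, hC⟩ := hs j
  refine ⟨C + 1, ?_⟩
  filter_upwards [hj, hC] with y h2 h3
  have := norm_sub_norm_le (φ y) (s j y)
  rw [norm_sub_rev] at this
  linarith

end LTendsto

end LocalConvergence

/-! ### Metric compatibility at a point, and uniqueness of covariant derivatives -/

section HermDeriv

variable {E : Type uE} [NormedAddCommGroup E] [NormedSpace ℝ E]
  {N : Type uN} [TopologicalSpace N] [ChartedSpace E N] [IsManifold 𝓘(ℝ, E) ∞ N]
  {H : N → Type uH} [∀ x, NormedAddCommGroup (H x)] [∀ x, InnerProductSpace ℂ (H x)]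

-- This is the Cauchy–Schwarz inequality; local boundedness of `ψ` replaces continuity, which has no
-- meaning yet for sections of `H`.
omit [ChartedSpace E N] [IsManifold 𝓘(ℝ, E) ∞ N] in
theorem LTendsto.herm {s : ℕ → ∀ x, H x} {φ ψ : ∀ x, H x} {x : N} (h : LTendsto s φ x)
    (hψ : LBounded ψ x) :
    Tendsto (fun p : ℕ × N => _root_.herm (s p.1) ψ p.2 - _root_.herm φ ψ p.2)
      (atTop ×ˢ 𝓝 x) (𝓝 0) := by
  obtain ⟨C, hC⟩ := hψ
  have h1 := Tendsto.const_mul C h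
  rw [mul_zero] at h1
  refine squeeze_zero_norm' ?_ h1
  filter_upwards [tendsto_snd.eventually hC] with p hp
  rw [_root_.herm, _root_.herm, ← inner_sub_right]
  exact (norm_inner_le_norm _ _).trans (mul_le_mul_of_nonneg_right hp (norm_nonneg _))

/-- The metric compatibility of the covariant derivatives `D` of `φ` and `D'` of `ψ` at the
point `x`. -/
def HermDeriv (φ : ∀ x, H x) (D : CVect (E := E) (⊤ : Opens N) → ∀ x, H x) (ψ : ∀ x, H x)
    (D' : CVect (E := E) (⊤ : Opens N) → ∀ x, H x) (x : N) : Prop :=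
  MDifferentiableAt 𝓘(ℝ, E) 𝓘(ℝ, ℂ) (herm φ ψ) x ∧
    ∀ X, X.deriv (herm φ ψ) x = herm (D X) ψ x + herm φ (D' X.conj) x

variable {φ φ' ψ : ∀ x, H x} {D D' : CVect (E := E) (⊤ : Opens N) → ∀ x, H x} {x : N}

theorem star_herm {N : Type uN} {H : N → Type uH} [∀ x, NormedAddCommGroup (H x)]
    [∀ x, InnerProductSpace ℂ (H x)] (φ ψ : ∀ x, H x) (x : N) :
    star (herm φ ψ x) = herm ψ φ x :=
  inner_conj_symm _ _

namespace HermDeriv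

/-- Complex conjugation exchanges `h(φ,ψ)` with `h(ψ,φ)` and `X` with `X.conj`. -/
theorem symm (h : HermDeriv φ D ψ D' x) : HermDeriv ψ D' φ D x := by
  have h0 : herm ψ φ = fun y => star (herm φ ψ y) := by
    funext y
    rw [star_herm]
  refine ⟨?_, fun X => ?_⟩
  · rw [h0]
    exact (HasMFDerivAt.star_complex h.1.hasMFDerivAt).mdifferentiableAt
  · rw [h0, X.deriv_star h.1, h.2, X.conj_conj, star_add, star_herm, star_herm, add_comm]

/-- The right-hand sides of the product rule for `h(s j, ψ)` converge locally uniformly, as `ψ` and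
`D'` are locally bounded, so `CVect.deriv_of_tendsto` applies. -/
theorem of_tendsto [FiniteDimensional ℝ E] [T2Space N] {s : ℕ → ∀ x, H x}
    {Ds : ℕ → CVect (E := E) (⊤ : Opens N) → ∀ x, H x}
    (hs : ∀ᶠ y in 𝓝 x, LTendsto s φ y) (hD : ∀ X, LTendsto (fun j => Ds j X) (D X) x)
    (h : ∀ᶠ y in 𝓝 x, ∀ j, HermDeriv (s j) (Ds j) ψ D' y)
    (hψ : LBounded ψ x) (hD' : ∀ X, LBounded (D' X) x) : HermDeriv φ D ψ D' x := by
  refine CVect.deriv_of_tendsto (f := fun j => herm (s j) ψ)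
    (g := fun X y => herm (D X) ψ y + herm φ (D' X.conj) y) (h.mono fun y hy j => (hy j).1) ?_ ?_
  · filter_upwards [hs] with y hy
    exact tendsto_const_nhds.inner hy.tendsto
  · intro X
    have h1 := ((hD X).herm hψ).add (hs.self_of_nhds.herm (hD' X.conj))
    rw [add_zero] at h1
    refine h1.congr' ?_
    filter_upwards [tendsto_snd.eventually h] with p hp
    rw [(hp p.1).2]
    ring

/-- The product rule fixes the inner products of `D X x` with `ψ x` for `ψ ∈ Γ`, and these values
are dense in the fibre. Only the germ of `φ` at `x` enters. -/
theorem unique {Γ : Set (∀ x, H x)} (hΓ : Dense {u : H x | ∃ φ ∈ Γ, φ x = u})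
    {D₁ D₂ : CVect (E := E) (⊤ : Opens N) → ∀ x, H x}
    (h : ∀ ψ ∈ Γ, ∃ D', HermDeriv φ D₁ ψ D' x ∧ HermDeriv φ' D₂ ψ D' x)
    (heq : ∀ᶠ y in 𝓝 x, φ y = φ' y) (X : CVect (E := E) (⊤ : Opens N)) : D₁ X x = D₂ X x := by
  refine ext_inner_left ℂ fun u => ?_
  have : (fun u : H x => inner ℂ u (D₁ X x)) = fun u => inner ℂ u (D₂ X x) := by
    refine Continuous.ext_on hΓ (by fun_prop) (by fun_prop) ?_
    rintro _ ⟨ψ, hψ, rfl⟩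
    obtain ⟨D', h1, h2⟩ := h ψ hψ
    have h3 : herm φ ψ =ᶠ[𝓝 x] herm φ' ψ := by
      filter_upwards [heq] with y hy
      rw [herm, herm, hy]
    have h4 := h1.2 X
    rw [X.deriv_congr h3, h2.2 X] at h4
    have h5 : herm φ (D' X.conj) x = herm φ' (D' X.conj) x := by
      rw [herm, herm, heq.self_of_nhds]
    rw [h5] at h4
    exact (add_right_cancel h4).symm
  exact congrFun this u

end HermDeriv

end HermDeriv

section HermDerivAlgebra

variable {E : Type uE} [NormedAddCommGroup E] [NormedSpace ℝ E]
  {N : Type uN} [TopologicalSpace N] [ChartedSpace E N] [IsManifold 𝓘(ℝ, E) ∞ N]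
  {H : N → Type uH} [∀ x, NormedAddCommGroup (H x)] [∀ x, InnerProductSpace ℂ (H x)]
  {φ φ' ψ : ∀ x, H x} {D₁ D₂ D' : CVect (E := E) (⊤ : Opens N) → ∀ x, H x} {x : N}

theorem HermDeriv.add (h₁ : HermDeriv φ D₁ ψ D' x) (h₂ : HermDeriv φ' D₂ ψ D' x) :
    HermDeriv (fun y => φ y + φ' y) (fun X y => D₁ X y + D₂ X y) ψ D' x := by
  have h0 : herm (fun y => φ y + φ' y) ψ = fun y => herm φ ψ y + herm φ' ψ y := by
    funext y
    exact inner_add_right _ _ _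
  refine ⟨h0 ▸ h₁.1.add h₂.1, fun X => ?_⟩
  rw [h0, X.deriv_add_fun h₁.1 h₂.1, h₁.2, h₂.2]
  simp only [herm, inner_add_right]
  ring

end HermDerivAlgebra

/-! ### Covariant derivatives of limits of elements of `Γ^∞` -/

namespace SmoothField

variable {E : Type uE} [NormedAddCommGroup E] [NormedSpace ℝ E]
  {N : Type uN} [TopologicalSpace N] [ChartedSpace E N] [IsManifold 𝓘(ℝ, E) ∞ N]
  {H : N → Type uH} [∀ x, NormedAddCommGroup (H x)] [∀ x, InnerProductSpace ℂ (H x)]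
  (S : SmoothField E H)

/-- The covariant derivatives of an element of `Γ^∞`, as sections. -/
def covF (φ : S.Γ) (X : CVect (E := E) (⊤ : Opens N)) : ∀ x, H x := (S.conn.cov X φ).1

/-- The product of a smooth function and an element of `Γ^∞`. -/
def smulΓ (a : CFun E N) (φ : S.Γ) : S.Γ := ⟨fun x => a x • φ.1 x, S.smul_mem a _ φ.2⟩

theorem covF_mem (φ : S.Γ) (X : CVect (E := E) (⊤ : Opens N)) : S.covF φ X ∈ S.Γ :=
  (S.conn.cov X φ).2

theorem hermDeriv (φ ψ : S.Γ) (x : N) : HermDeriv φ.1 (S.covF φ) ψ.1 (S.covF ψ) x :=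
  ⟨(S.conn.herm_smooth φ ψ).mdifferentiableAt (by simp), fun X => S.conn.herm_deriv X φ ψ x⟩

theorem lbounded (φ : S.Γ) (x : N) : LBounded φ.1 x := by
  have h1 : ContinuousAt (fun y => ‖herm φ.1 φ.1 y‖) x :=
    (S.conn.herm_smooth φ φ).continuous.norm.continuousAt
  -- The first `1` comes from continuity of `‖φ‖²`, the second from `t ≤ t² + 1`, which passes from
  -- `‖φ y‖²` to `‖φ y‖`.
  refine ⟨‖herm φ.1 φ.1 x‖ + 1 + 1, ?_⟩
  filter_upwards [h1.eventually (gt_mem_nhds (lt_add_one _))] with y hy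
  have h2 : ‖herm φ.1 φ.1 y‖ = ‖φ.1 y‖ ^ 2 := by
    rw [herm, inner_self_eq_norm_sq_to_K, norm_pow]
    simp
  rw [h2] at hy
  nlinarith [sq_nonneg (‖φ.1 y‖ - 1), norm_nonneg (φ.1 y)]

theorem covF_smulΓ (a : CFun E N) (φ : S.Γ) (X : CVect (E := E) (⊤ : Opens N)) (x : N) :
    S.covF (S.smulΓ a φ) X x = X.deriv a x • φ.1 x + a x • S.covF φ X x :=
  S.conn.leibniz a X φ (S.smul_mem a _ φ.2) x

/-- Additivity in the section is not an axiom of `HermConn`; both sides satisfy the same product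
rule against `Γ^∞`, so uniqueness yields it. -/
theorem covF_add (φ ψ : S.Γ) (X : CVect (E := E) (⊤ : Opens N)) (x : N) :
    S.covF (φ + ψ) X x = S.covF φ X x + S.covF ψ X x :=
  HermDeriv.unique (φ := (φ + ψ).1) (φ' := fun y => φ.1 y + ψ.1 y) (D₁ := S.covF (φ + ψ))
    (D₂ := fun X y => S.covF φ X y + S.covF ψ X y) (S.dense x)
    (fun χ hχ => ⟨S.covF ⟨χ, hχ⟩, S.hermDeriv (φ + ψ) ⟨χ, hχ⟩ x,
      (S.hermDeriv φ ⟨χ, hχ⟩ x).add (S.hermDeriv ψ ⟨χ, hχ⟩ x)⟩)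
    (Eventually.of_forall fun _ => rfl) X

theorem covF_zero (X : CVect (E := E) (⊤ : Opens N)) (x : N) : S.covF 0 X x = 0 := by
  simpa using S.covF_add 0 0 X x

theorem covF_sum {κ : Type*} (F : Finset κ) (φ : κ → S.Γ) (X : CVect (E := E) (⊤ : Opens N))
    (x : N) : S.covF (∑ k ∈ F, φ k) X x = ∑ k ∈ F, S.covF (φ k) X x := by
  classical
  induction F using Finset.induction_on with
  | empty => simpa using S.covF_zero X x
  | insert k F hk ih => rw [Finset.sum_insert hk, Finset.sum_insert hk, covF_add, ih]

/-- On the set `U`, the section `φ` has the covariant derivatives `D`, which are limits of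
covariant derivatives of elements of `Γ^∞` that converge to `φ`. -/
def IsCov (U : Set N) (φ : ∀ x, H x) (D : CVect (E := E) (⊤ : Opens N) → ∀ x, H x) : Prop :=
  ∃ s : ℕ → S.Γ, ∀ x ∈ U, LTendsto (fun j => (s j).1) φ x ∧
    ∀ X, LTendsto (fun j => S.covF (s j) X) (D X) x

variable {S}

namespace IsCov

variable {U V : Set N} {φ ψ : ∀ x, H x} {D D' : CVect (E := E) (⊤ : Opens N) → ∀ x, H x} {x : N}

theorem of_mem (U : Set N) (φ : S.Γ) : S.IsCov U φ.1 (S.covF φ) :=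
  ⟨fun _ => φ, fun x _ => ⟨LTendsto.refl _ x, fun _ => LTendsto.refl _ x⟩⟩

theorem mono (h : S.IsCov U φ D) (hVU : V ⊆ U) : S.IsCov V φ D :=
  h.imp fun _ hs x hx => hs x (hVU hx)

theorem congr (h : S.IsCov U φ D) (hU : IsOpen U) (hφ : ∀ y ∈ U, φ y = ψ y)
    (hD : ∀ X, ∀ y ∈ U, D X y = D' X y) : S.IsCov U ψ D' := by
  obtain ⟨s, hs⟩ := h
  refine ⟨s, fun x hx => ⟨(hs x hx).1.congr (Eventually.of_forall fun _ _ => rfl) ?_, fun X =>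
    ((hs x hx).2 X).congr (Eventually.of_forall fun _ _ => rfl) ?_⟩⟩
  · filter_upwards [hU.mem_nhds hx] with y hy using hφ y hy
  · filter_upwards [hU.mem_nhds hx] with y hy using hD X y hy

theorem lbounded (h : S.IsCov U φ D) (hx : x ∈ U) : LBounded φ x := by
  obtain ⟨s, hs⟩ := h
  exact (hs x hx).1.lbounded fun j => S.lbounded _ x

theorem lbounded_cov (h : S.IsCov U φ D) (hx : x ∈ U) (X : CVect (E := E) (⊤ : Opens N)) :
    LBounded (D X) x := by
  obtain ⟨s, hs⟩ := h
  exact ((hs x hx).2 X).lbounded fun j => S.lbounded ⟨_, S.covF_mem (s j) X⟩ x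

/-- This takes the limit in the first argument only. It is used first with `ψ` in `Γ^∞` and then,
after `HermDeriv.symm`, with `ψ` itself a limit, which avoids a double limit. -/
theorem hermDeriv_of_forall [FiniteDimensional ℝ E] [T2Space N] (h : S.IsCov U φ D)
    (hU : IsOpen U) (hx : x ∈ U)
    (hψ : ∀ y ∈ U, ∀ σ : S.Γ, HermDeriv σ.1 (S.covF σ) ψ D' y)
    (hb : LBounded ψ x) (hb' : ∀ X, LBounded (D' X) x) : HermDeriv φ D ψ D' x := by
  obtain ⟨s, hs⟩ := h
  refine HermDeriv.of_tendsto (s := fun j => (s j).1) (Ds := fun j => S.covF (s j)) ?_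
    (hs x hx).2 ?_ hb hb'
  · filter_upwards [hU.mem_nhds hx] with y hy using (hs y hy).1
  · filter_upwards [hU.mem_nhds hx] with y hy j using hψ y hy (s j)

theorem hermDeriv_mem [FiniteDimensional ℝ E] [T2Space N] (h : S.IsCov U φ D) (hU : IsOpen U)
    (hx : x ∈ U) (ψ : S.Γ) : HermDeriv φ D ψ.1 (S.covF ψ) x :=
  h.hermDeriv_of_forall hU hx (fun y _ σ => S.hermDeriv σ ψ y) (S.lbounded ψ x)
    fun X => S.lbounded ⟨_, S.covF_mem ψ X⟩ x

theorem hermDeriv [FiniteDimensional ℝ E] [T2Space N] (h : S.IsCov U φ D) (h' : S.IsCov U ψ D')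
    (hU : IsOpen U) (hx : x ∈ U) : HermDeriv φ D ψ D' x :=
  h.hermDeriv_of_forall hU hx (fun _ hy σ => (h'.hermDeriv_mem hU hy σ).symm)
    (h'.lbounded hx) (h'.lbounded_cov hx)

theorem unique [FiniteDimensional ℝ E] [T2Space N] (h : S.IsCov U φ D) (h' : S.IsCov V ψ D')
    (hU : IsOpen U) (hV : IsOpen V) (hxU : x ∈ U) (hxV : x ∈ V) (heq : ∀ᶠ y in 𝓝 x, φ y = ψ y)
    (X : CVect (E := E) (⊤ : Opens N)) : D X x = D' X x :=
  HermDeriv.unique (S.dense x) (fun χ hχ => ⟨S.covF ⟨χ, hχ⟩, h.hermDeriv_mem hU hxU ⟨χ, hχ⟩,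
    h'.hermDeriv_mem hV hxV ⟨χ, hχ⟩⟩) heq X

theorem add (h : S.IsCov U φ D) (h' : S.IsCov U ψ D') :
    S.IsCov U (fun y => φ y + ψ y) (fun X y => D X y + D' X y) := by
  obtain ⟨s, hs⟩ := h
  obtain ⟨t, ht⟩ := h'
  refine ⟨fun j => s j + t j, fun x hx => ⟨(hs x hx).1.add (ht x hx).1, fun X => ?_⟩⟩
  refine (((hs x hx).2 X).add ((ht x hx).2 X)).congr (Eventually.of_forall fun y j => ?_)
    (Eventually.of_forall fun _ => rfl)
  exact (S.covF_add (s j) (t j) X y).symm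

/-- Multiply the approximating sequence by `a`: the Leibniz rule gives convergent derivatives
because `a` and `X(a)` are continuous. -/
theorem smul (a : CFun E N) (h : S.IsCov U φ D) :
    S.IsCov U (fun y => a y • φ y) (fun X y => X.deriv a y • φ y + a y • D X y) := by
  obtain ⟨s, hs⟩ := h
  refine ⟨fun j => S.smulΓ a (s j), fun x hx => ⟨?_, fun X => ?_⟩⟩
  · exact (hs x hx).1.smul a.contMDiff.continuous.continuousAt
  · refine LTendsto.congr (((hs x hx).1.smul (X.derivFun a).contMDiff.continuous.continuousAt).add
      (((hs x hx).2 X).smul a.contMDiff.continuous.continuousAt))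
      (Eventually.of_forall fun y j => ?_) (Eventually.of_forall fun _ => rfl)
    exact (S.covF_smulΓ a (s j) X y).symm

end IsCov

variable (S)

/-- The sections which are `n` times differentiable on the set `U`; their values at other points
are irrelevant. -/
def DiffOn (U : Set N) : ℕ → Set (∀ x, H x)
  | 0 => {φ | ∃ s : ℕ → S.Γ, ∀ x ∈ U, LTendsto (fun j => (s j).1) φ x}
  | 1 => {φ | ∃ D, S.IsCov U φ D}
  | n + 2 => {φ | φ ∈ DiffOn U (n + 1) ∧ ∃ D, S.IsCov U φ D ∧ ∀ X, D X ∈ DiffOn U (n + 1)}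

variable {S}
variable {U V : Set N} {φ ψ : ∀ x, H x} {n : ℕ}

theorem DiffOn.mono (h : φ ∈ S.DiffOn U n) (hVU : V ⊆ U) : φ ∈ S.DiffOn V n := by
  induction n using Nat.twoStepInduction generalizing φ with
  | zero => exact h.imp fun _ hs x hx => hs x (hVU hx)
  | one => exact h.imp fun _ hD => hD.mono hVU
  | more n _ ih =>
    obtain ⟨h1, D, hD, h2⟩ := h
    exact ⟨ih h1, D, hD.mono hVU, fun X => ih (h2 X)⟩

theorem DiffOn.congr (h : φ ∈ S.DiffOn U n) (hU : IsOpen U) (hφ : ∀ y ∈ U, φ y = ψ y) :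
    ψ ∈ S.DiffOn U n := by
  induction n using Nat.twoStepInduction with
  | zero =>
    refine h.imp fun _ hs x hx => (hs x hx).congr (Eventually.of_forall fun _ _ => rfl) ?_
    filter_upwards [hU.mem_nhds hx] with y hy using hφ y hy
  | one => exact h.imp fun _ hD => hD.congr hU hφ fun _ _ _ => rfl
  | more n _ ih =>
    obtain ⟨h1, D, hD, h2⟩ := h
    exact ⟨ih h1, D, hD.congr hU hφ fun _ _ _ => rfl, h2⟩

theorem DiffOn.of_mem (U : Set N) (n : ℕ) (φ : S.Γ) : φ.1 ∈ S.DiffOn U n := by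
  induction n using Nat.twoStepInduction generalizing φ with
  | zero => exact ⟨fun _ => φ, fun x _ => LTendsto.refl _ x⟩
  | one => exact ⟨_, IsCov.of_mem U φ⟩
  | more n _ ih => exact ⟨ih φ, _, IsCov.of_mem U φ, fun X => ih ⟨_, S.covF_mem φ X⟩⟩

theorem DiffOn.add (h : φ ∈ S.DiffOn U n) (h' : ψ ∈ S.DiffOn U n) :
    (fun y => φ y + ψ y) ∈ S.DiffOn U n := by
  induction n using Nat.twoStepInduction generalizing φ ψ with
  | zero =>
    obtain ⟨s, hs⟩ := h
    obtain ⟨t, ht⟩ := h'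
    exact ⟨fun j => s j + t j, fun x hx => (hs x hx).add (ht x hx)⟩
  | one =>
    obtain ⟨D, hD⟩ := h
    obtain ⟨D', hD'⟩ := h'
    exact ⟨_, hD.add hD'⟩
  | more n _ ih =>
    obtain ⟨h1, D, hD, h2⟩ := h
    obtain ⟨h1', D', hD', h2'⟩ := h'
    exact ⟨ih h1 h1', _, hD.add hD', fun X => ih (h2 X) (h2' X)⟩

theorem DiffOn.smul (a : CFun E N) (h : φ ∈ S.DiffOn U n) :
    (fun y => a y • φ y) ∈ S.DiffOn U n := by
  induction n using Nat.twoStepInduction generalizing φ a with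
  | zero =>
    obtain ⟨s, hs⟩ := h
    exact ⟨fun j => S.smulΓ a (s j), fun x hx =>
      (hs x hx).smul a.contMDiff.continuous.continuousAt⟩
  | one =>
    obtain ⟨D, hD⟩ := h
    exact ⟨_, hD.smul a⟩
  | more n _ ih =>
    obtain ⟨h1, D, hD, h2⟩ := h
    -- The Leibniz term has the coefficient `X(a)`, hence the induction over all smooth `a` at once.
    exact ⟨ih a h1, _, hD.smul a, fun X => DiffOn.add (ih (X.derivFun a) h1) (ih a (h2 X))⟩

end SmoothField

/-! ### Smooth cut-offs -/

section Cutoffs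

variable {E : Type uE} [NormedAddCommGroup E] [NormedSpace ℝ E] [FiniteDimensional ℝ E]
  {N : Type uN} [TopologicalSpace N] [T2Space N] [ChartedSpace E N] [IsManifold 𝓘(ℝ, E) ∞ N]

/-- A smooth real function, as a smooth complex function. -/
def CFun.ofReal (f : N → ℝ) (hf : ContMDiff 𝓘(ℝ, E) 𝓘(ℝ, ℝ) ∞ f) : CFun E N :=
  ⟨fun y => (f y : ℂ), (Complex.ofRealCLM.contMDiff (n := ∞)).comp hf⟩

theorem exists_smooth_bump (x : N) {V : Set N} (hV : V ∈ 𝓝 x) :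
    ∃ f : N → ℝ, ContMDiff 𝓘(ℝ, E) 𝓘(ℝ, ℝ) ∞ f ∧ tsupport f ⊆ V ∧ ∀ᶠ y in 𝓝 x, f y = 1 := by
  obtain ⟨f, hf, -⟩ := ((SmoothBumpFunction.nhds_basis_support (I := 𝓘(ℝ, E)) hV).mem_iff).1 hV
  exact ⟨f, f.contMDiff, hf, f.eventuallyEq_one⟩

/-- Smooth functions with prescribed supports that sum up to one on the open set `U`. -/
theorem exists_smooth_cutoffs [SecondCountableTopology N] {U : Set N} (hne : U.Nonempty)
    {V : N → Set N} (hV : ∀ x ∈ U, V x ∈ 𝓝 x) :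
    ∃ (χ : ℕ → CFun E N) (c : ℕ → N), (∀ k, c k ∈ U) ∧ (∀ k, tsupport (χ k) ⊆ V (c k)) ∧
      ∀ x ∈ U, ∃ l, ∀ᶠ y in 𝓝 x, ∀ j ≥ l, χ j y = 0 ∧ ∑ k ∈ Finset.range j, χ k y = 1 := by
  classical
  have hb : ∀ x : N, ∃ f : N → ℝ, ContMDiff 𝓘(ℝ, E) 𝓘(ℝ, ℝ) ∞ f ∧
      (x ∈ U → tsupport f ⊆ V x) ∧ ∀ᶠ y in 𝓝 x, f y = 1 := by
    intro x
    by_cases hx : x ∈ U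
    · obtain ⟨f, h1, h2, h3⟩ := exists_smooth_bump (E := E) x (hV x hx)
      exact ⟨f, h1, fun _ => h2, h3⟩
    · exact ⟨fun _ => 1, contMDiff_const, fun h => absurd h hx, Eventually.of_forall fun _ => rfl⟩
  choose b hbs hbt hb1 using hb
  -- By second countability, countably many of the sets on which a bump function is 1 cover `U`.
  obtain ⟨t, htU, htc, hcov⟩ := countable_cover_nhdsWithin (s := U)
    (f := fun x => interior {y | b x y = 1})
    (fun x _ => mem_nhdsWithin_of_mem_nhds (interior_mem_nhds.2 (hb1 x)))
  have htne : t.Nonempty := by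
    obtain ⟨x, hx⟩ := hne
    obtain ⟨y, hy, -⟩ := mem_iUnion₂.1 (hcov hx)
    exact ⟨y, hy⟩
  obtain ⟨c, rfl⟩ := htc.exists_eq_range htne
  -- With `χ k = b k * ∏_{l<k} (1 - b l)`, where `b k` is the bump at `c k`, the partial sums
  -- telescope to `1 - p n`; both `p n` and `χ n` vanish as soon as some earlier bump equals 1.
  let p : ℕ → N → ℝ := fun n y => ∏ l ∈ Finset.range n, (1 - b (c l) y)
  have hp : ∀ n, ContMDiff 𝓘(ℝ, E) 𝓘(ℝ, ℝ) ∞ (p n) := fun n =>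
    contMDiff_finsetProd fun l _ => contMDiff_const.sub (hbs (c l))
  have hpS : ∀ n y, p (n + 1) y = p n y * (1 - b (c n) y) := fun n y => Finset.prod_range_succ _ _
  refine ⟨fun k => CFun.ofReal (fun y => b (c k) y * p k y) ((hbs (c k)).mul (hp k)), c,
    fun k => htU (mem_range_self k), fun k => ?_, fun x hx => ?_⟩
  · refine Subset.trans ?_ (hbt (c k) (htU (mem_range_self k)))
    refine closure_mono fun y hy => ?_
    contrapose! hy
    have h0 : b (c k) y = 0 := by simpa using hy
    have : (((b (c k) y * p k y : ℝ) : ℂ)) = 0 := by rw [h0, zero_mul, Complex.ofReal_zero]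
    exact Function.notMem_support.2 this
  · have hsum : ∀ n y, ∑ k ∈ Finset.range n, b (c k) y * p k y = 1 - p n y := by
      intro n y
      induction n with
      | zero => simp [p]
      | succ n ih =>
        rw [Finset.sum_range_succ, ih, hpS]
        ring
    obtain ⟨z, hz, hxz⟩ := mem_iUnion₂.1 (hcov hx)
    obtain ⟨l, rfl⟩ := hz
    -- The factor with index `l` occurs in `p j` only for `j > l`.
    refine ⟨l + 1, ?_⟩
    filter_upwards [isOpen_interior.mem_nhds hxz] with y hy j hj
    have hy1 : b (c l) y = 1 := interior_subset (s := {y | b (c l) y = 1}) hy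
    have hp0 : p j y = 0 :=
      Finset.prod_eq_zero (Finset.mem_range.2 hj) (by rw [hy1, sub_self])
    constructor
    · change ((b (c j) y * p j y : ℝ) : ℂ) = 0
      rw [hp0, mul_zero, Complex.ofReal_zero]
    · change ∑ k ∈ Finset.range j, ((b (c k) y * p k y : ℝ) : ℂ) = 1
      rw [← Complex.ofReal_sum, hsum, hp0, sub_zero, Complex.ofReal_one]

end Cutoffs

/-! ### Gluing covariant derivatives; differentiability is local -/

section Gluing

/-- Near `x` only the terms with `k < l` survive, and a term whose support misses `x` vanishes near
`x`, so convergence of `u k` is needed only on the support of `χ k`. The constant `c` is 1 for the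
cut-offs and 0 for their derivatives. -/
theorem LTendsto.sum_cutoffs {N : Type uN} [TopologicalSpace N] {H : N → Type uH}
    [∀ x, NormedAddCommGroup (H x)] [∀ x, NormedSpace ℂ (H x)]
    {χ : ℕ → N → ℂ} (hχ : ∀ k, Continuous (χ k)) {u : ℕ → ℕ → ∀ x, H x}
    {φ : ∀ x, H x} {x : N} {c : ℂ} (hu : ∀ k, x ∈ tsupport (χ k) → LTendsto (u k) φ x) {l : ℕ}
    (hl : ∀ᶠ y in 𝓝 x, ∀ j ≥ l, χ j y = 0 ∧ ∑ k ∈ Finset.range j, χ k y = c) :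
    LTendsto (fun j y => ∑ k ∈ Finset.range j, χ k y • u k j y) (fun y => c • φ y) x := by
  have h1 : ∀ k, LTendsto (fun j y => χ k y • u k j y) (fun y => χ k y • φ y) x := by
    intro k
    by_cases hk : x ∈ tsupport (χ k)
    · exact (hu k hk).smul (hχ k).continuousAt
    · have h0 := notMem_tsupport_iff_eventuallyEq.1 hk
      refine (LTendsto.refl (fun y => (0 : H y)) x).congr ?_ ?_
      · filter_upwards [h0] with y hy j
        simp [hy]
      · filter_upwards [h0] with y hy
        simp [hy]
  refine (LTendsto.sum (Finset.range l) fun k _ => h1 k).congr' ?_ ?_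
  · filter_upwards [tendsto_fst.eventually (eventually_ge_atTop l), tendsto_snd.eventually hl]
      with p hp1 hp2
    refine Finset.sum_subset (Finset.range_mono hp1) fun k _ hk => ?_
    rw [(hp2 k (by simpa using hk)).1, zero_smul]
  · filter_upwards [hl] with y hy
    rw [← Finset.sum_smul, (hy l le_rfl).2]

variable {E : Type uE} [NormedAddCommGroup E] [NormedSpace ℝ E] [FiniteDimensional ℝ E]
  {N : Type uN} [TopologicalSpace N] [T2Space N] [SecondCountableTopology N]
  [ChartedSpace E N] [IsManifold 𝓘(ℝ, E) ∞ N]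
  {H : N → Type uH} [∀ x, NormedAddCommGroup (H x)] [∀ x, InnerProductSpace ℂ (H x)]
  {S : SmoothField E H}

namespace SmoothField

/-- Sections with the same covariant derivatives can be glued. -/
theorem IsCov.glue {U : Set N} {V : N → Set N} (hV : ∀ x ∈ U, V x ∈ 𝓝 x) {φ : ∀ x, H x}
    {D : CVect (E := E) (⊤ : Opens N) → ∀ x, H x} (h : ∀ x ∈ U, S.IsCov (V x) φ D) :
    S.IsCov U φ D := by
  rcases U.eq_empty_or_nonempty with rfl | hne
  · exact ⟨fun _ => 0, fun x hx => hx.elim⟩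
  obtain ⟨χ, c, hc, hsup, hχ⟩ := exists_smooth_cutoffs (E := E) hne hV
  choose! s hs using h
  -- Truncating at `j` keeps the sums finite, hence in `Γ^∞`; near a given point this is eventually
  -- the full sum.
  refine ⟨fun j => ∑ k ∈ Finset.range j, S.smulΓ (χ k) (s (c k) j), fun x hx => ?_⟩
  obtain ⟨l, hl⟩ := hχ x hx
  have hcont : ∀ k, Continuous (χ k) := fun k => (χ k).contMDiff.continuous
  refine ⟨?_, fun X => ?_⟩
  · refine (LTendsto.sum_cutoffs hcont (u := fun k j => (s (c k) j).1) (φ := φ) ?_ hl).congr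
      (Eventually.of_forall fun y j => ?_) (Eventually.of_forall fun y => one_smul _ _)
    · intro k hk
      exact (hs (c k) (hc k) x (hsup k hk)).1
    · rw [Submodule.coe_sum, Finset.sum_apply]
      rfl
  · have h1 := LTendsto.sum_cutoffs hcont (u := fun k j => S.covF (s (c k) j) X) (φ := D X)
      (fun k hk => (hs (c k) (hc k) x (hsup k hk)).2 X) hl
    -- The cut-offs sum to 1 near `x`, so their derivatives sum to 0 and the Leibniz terms
    -- containing `φ` disappear in the limit.
    have hl' : ∀ᶠ y in 𝓝 x, ∀ j ≥ l, X.deriv (χ j) y = 0 ∧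
        ∑ k ∈ Finset.range j, X.deriv (χ k) y = 0 := by
      filter_upwards [hl.eventually_nhds] with y hy j hj
      constructor
      · rw [X.deriv_congr (g := fun _ => 0) (hy.mono fun z hz => (hz j hj).1), X.deriv_const]
      · rw [← (X.deriv_sum (Finset.range j) fun k _ => (χ k).mdifferentiableAt y).2,
          X.deriv_congr (g := fun _ => 1) (hy.mono fun z hz => (hz j hj).2), X.deriv_const]
    have h2 := LTendsto.sum_cutoffs (χ := fun k => X.deriv (χ k))
      (fun k => (X.derivFun (χ k)).contMDiff.continuous) (u := fun k j => (s (c k) j).1) (φ := φ)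
      (fun k hk => (hs (c k) (hc k) x (hsup k ?_)).1) hl'
    · refine (h2.add h1).congr (Eventually.of_forall fun y j => ?_)
        (Eventually.of_forall fun y => by simp)
      rw [covF_sum, ← Finset.sum_add_distrib]
      exact Finset.sum_congr rfl fun k _ => (S.covF_smulΓ _ _ X y).symm
    · contrapose! hk
      have h0 := notMem_tsupport_iff_eventuallyEq.1 hk
      rw [notMem_tsupport_iff_eventuallyEq]
      filter_upwards [h0.eventually_nhds] with y hy
      exact (X.deriv_congr hy).trans (X.deriv_const 0 y)

theorem IsCov.exists_of_local {U : Set N} (hU : IsOpen U) {φ : ∀ x, H x}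
    (h : ∀ x ∈ U, ∃ V, IsOpen V ∧ x ∈ V ∧ ∃ D, S.IsCov V φ D) : ∃ D, S.IsCov U φ D := by
  have h' : ∀ x, ∃ V, ∃ D, x ∈ U → IsOpen V ∧ x ∈ V ∧ S.IsCov V φ D := by
    intro x
    by_cases hx : x ∈ U
    · obtain ⟨V, h1, h2, D, hD⟩ := h x hx
      exact ⟨V, D, fun _ => ⟨h1, h2, hD⟩⟩
    · exact ⟨∅, fun _ _ => 0, fun h => absurd h hx⟩
  choose V D hVD using h'
  -- The value at `y` is taken from the local derivative chosen for `y`; by uniqueness, it agrees on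
  -- `V x ∩ U` with the one chosen for `x`.
  refine ⟨fun X y => D y X y, IsCov.glue (V := fun x => V x ∩ U)
    (fun x hx => inter_mem ((hVD x hx).1.mem_nhds (hVD x hx).2.1) (hU.mem_nhds hx)) fun x hx => ?_⟩
  refine ((hVD x hx).2.2.mono inter_subset_left).congr ((hVD x hx).1.inter hU) (fun _ _ => rfl)
    fun X y hy => ?_
  exact IsCov.unique (hVD x hx).2.2 (hVD y hy.2).2.2 (hVD x hx).1 (hVD y hy.2).1 hy.1
    (hVD y hy.2).2.1 (Eventually.of_forall fun _ => rfl) X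

/-- Differentiability of sections is a local property. -/
theorem DiffOn.of_local {U : Set N} (hU : IsOpen U) {φ : ∀ x, H x} {n : ℕ}
    (h : ∀ x ∈ U, ∃ V, IsOpen V ∧ x ∈ V ∧ φ ∈ S.DiffOn V n) : φ ∈ S.DiffOn U n := by
  induction n using Nat.twoStepInduction generalizing φ with
  | zero =>
    choose! V hVo hxV hVd using h
    rcases U.eq_empty_or_nonempty with rfl | hne
    · exact ⟨fun _ => 0, fun x hx => hx.elim⟩
    obtain ⟨χ, c, hc, hsup, hχ⟩ := exists_smooth_cutoffs (E := E) hne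
      fun x hx => (hVo x hx).mem_nhds (hxV x hx)
    choose! s hs using hVd
    refine ⟨fun j => ∑ k ∈ Finset.range j, S.smulΓ (χ k) (s (c k) j), fun x hx => ?_⟩
    obtain ⟨l, hl⟩ := hχ x hx
    refine (LTendsto.sum_cutoffs (fun k => (χ k).contMDiff.continuous)
      (u := fun k j => (s (c k) j).1) (φ := φ) ?_ hl).congr
      (Eventually.of_forall fun y j => ?_) (Eventually.of_forall fun y => one_smul _ _)
    · intro k hk
      exact hs (c k) (hc k) x (hsup k hk)
    · rw [Submodule.coe_sum, Finset.sum_apply]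
      rfl
  | one =>
    exact IsCov.exists_of_local hU h
  | more n _ ih =>
    have h1 : ∀ x ∈ U, ∃ V, IsOpen V ∧ x ∈ V ∧ ∃ D, S.IsCov V φ D ∧
        ∀ X, D X ∈ S.DiffOn V (n + 1) := fun x hx => by
      obtain ⟨V, hV, hxV, -, hD⟩ := h x hx
      exact ⟨V, hV, hxV, hD⟩
    obtain ⟨D, hD⟩ := IsCov.exists_of_local hU fun x hx => by
      obtain ⟨V, hV, hxV, D, hD, -⟩ := h1 x hx
      exact ⟨V, hV, hxV, D, hD⟩
    refine ⟨ih fun x hx => ?_, D, hD, fun X => ih fun x hx => ?_⟩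
    · obtain ⟨V, hV, hxV, hφ, -⟩ := h x hx
      exact ⟨V, hV, hxV, hφ⟩
    · obtain ⟨V, hV, hxV, D', hD', hX⟩ := h1 x hx
      refine ⟨V ∩ U, hV.inter hU, ⟨hxV, hx⟩, DiffOn.congr (DiffOn.mono (hX X) inter_subset_left)
        (hV.inter hU) ?_⟩
      intro y hy
      exact IsCov.unique hD' hD hV hU hy.1 hy.2 (Eventually.of_forall fun _ => rfl) X

end SmoothField

end Gluing

/-! ### Sections over `U` versus globally defined sections -/

section Comparison

theorem secTendsto_iff {N : Type uN} [TopologicalSpace N] {H : N → Type uH}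
    [∀ x, NormedAddCommGroup (H x)] {U : Opens N} {s : ℕ → ∀ x : U, H x} {φ : ∀ x : U, H x} :
    SecTendsto s φ ↔ ∀ x : U, Tendsto (fun p : ℕ × U => ‖s p.1 p.2 - φ p.2‖)
      (atTop ×ˢ 𝓝 x) (𝓝 0) := by
  rw [SecTendsto, tendstoLocallyUniformly_iff_forall_tendsto]
  refine forall_congr' fun x => ?_
  rw [tendsto_uniformity_iff_dist_tendsto_zero]
  simp [Real.dist_eq]

theorem lTendsto_iff_of_eventuallyEq {N : Type uN} [TopologicalSpace N] {H : N → Type uH}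
    [∀ x, NormedAddCommGroup (H x)] {U : Opens N} {s : ℕ → ∀ x : U, H x} {φ : ∀ x : U, H x}
    {t : ℕ → ∀ x, H x} {ψ : ∀ x, H x} {x : U}
    (h : ∀ᶠ y : U in 𝓝 x, (∀ j, t j y = s j y) ∧ ψ y = φ y) :
    LTendsto t ψ x ↔
      Tendsto (fun p : ℕ × U => ‖s p.1 p.2 - φ p.2‖) (atTop ×ˢ 𝓝 x) (𝓝 0) := by
  rw [LTendsto, ← U.isOpenEmbedding'.map_nhds_eq x, prod_map_right, tendsto_map'_iff]
  refine tendsto_congr' ?_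
  filter_upwards [tendsto_snd.eventually h] with p hp
  simp [hp.1, hp.2]

theorem secTendsto_iff_lTendsto {N : Type uN} [TopologicalSpace N] {H : N → Type uH}
    [∀ x, NormedAddCommGroup (H x)] {U : Opens N} {s : ℕ → ∀ x : U, H x} {φ : ∀ x : U, H x}
    {t : ℕ → ∀ x, H x} {ψ : ∀ x, H x} (hs : ∀ j (x : U), t j x = s j x)
    (hφ : ∀ x : U, ψ x = φ x) : SecTendsto s φ ↔ ∀ x ∈ U, LTendsto t ψ x := by
  rw [secTendsto_iff, Subtype.forall]
  exact forall₂_congr fun x hx => (lTendsto_iff_of_eventuallyEq (x := ⟨x, hx⟩)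
    (Eventually.of_forall fun y : U => ⟨fun j => hs j y, hφ y⟩)).symm

variable {E : Type uE} [NormedAddCommGroup E] [NormedSpace ℝ E]
  {N : Type uN} [TopologicalSpace N] [ChartedSpace E N] [IsManifold 𝓘(ℝ, E) ∞ N]

/-- The restriction of a vector field to an open subset. -/
def CVect.restrict (U : Opens N) (X : CVect (E := E) (⊤ : Opens N)) : CVect (E := E) U where
  re := X.re
  im := X.im
  smooth_re := X.smooth_re.mono fun _ _ => trivial
  smooth_im := X.smooth_im.mono fun _ _ => trivial

variable [FiniteDimensional ℝ E] [T2Space N]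
  {H : N → Type uH} [∀ x, NormedAddCommGroup (H x)] [∀ x, InnerProductSpace ℂ (H x)]
  {S : SmoothField E H}

namespace CVect

theorem extend_eventuallyEq {U : Opens N} (X : CVect (E := E) U) (x : U) :
    ∀ᶠ y in 𝓝 (x : N), (X.extend x).re y = X.re y ∧ (X.extend x).im y = X.im y :=
  (X.exists_extend x).choose_spec

end CVect

namespace SmoothField

theorem covOn_restrict (U : Opens N) (X : CVect (E := E) (⊤ : Opens N)) (σ : S.Γ) (x : U) :
    S.covOn U (X.restrict U) σ x = S.covF σ X x :=
  S.covOn_eq U (X.restrict U) σ x X (Eventually.of_forall fun _ => ⟨rfl, rfl⟩)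

/-- `covOn` picks an extension of `X` for each point separately; a single extension serves a whole
neighbourhood, which is what locally uniform convergence requires. -/
theorem covOn_eventuallyEq {U : Opens N} (X : CVect (E := E) U) (x : U) :
    ∀ᶠ y : U in 𝓝 x, ∀ σ : S.Γ, S.covF σ (X.extend x) y = S.covOn U X σ y := by
  have h := (X.extend_eventuallyEq x).eventually_nhds
  filter_upwards [(continuous_subtype_val.tendsto x).eventually h] with y hy σ
  exact (S.covOn_eq U X σ y _ hy).symm

theorem IsCov.extend_eventuallyEq {U : Opens N} {φ : ∀ x, H x}
    {D : CVect (E := E) (⊤ : Opens N) → ∀ x, H x} (h : S.IsCov U φ D)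
    (X : CVect (E := E) U) (x : U) :
    ∀ᶠ y : U in 𝓝 x, D (X.extend x) y = D (X.extend y) y := by
  obtain ⟨s, hs⟩ := h
  filter_upwards [covOn_eventuallyEq (S := S) X x] with y hy
  have h1 := ((hs y y.2).2 (X.extend x)).tendsto
  have h2 := ((hs y y.2).2 (X.extend y)).tendsto
  refine tendsto_nhds_unique (h1.congr fun j => ?_) h2
  exact hy (s j)

theorem HasCov.isCov {U : Opens N} {φ : ∀ x, H x} {D : CVect (E := E) U → ∀ x : U, H x}
    {D' : CVect (E := E) (⊤ : Opens N) → ∀ x, H x} (h : S.HasCov U (fun x => φ x) D)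
    (hD : ∀ X (x : U), D' X x = D (X.restrict U) x) : S.IsCov U φ D' := by
  obtain ⟨s, h1, h2⟩ := h
  refine ⟨s, fun x hx => ⟨?_, fun X => ?_⟩⟩
  · exact (secTendsto_iff_lTendsto (t := fun j => (s j).1) (fun _ _ => rfl) fun _ => rfl).1 h1 x hx
  · exact (secTendsto_iff_lTendsto (t := fun j => S.covF (s j) X)
      (fun j x => (covOn_restrict U X (s j) x).symm) (hD X)).1 (h2 (X.restrict U)) x hx

/-- `IsCov` tests only vector fields on `N`, but near each point of `U` a field on `U` agrees with
one of these, and convergence is tested point by point. -/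
theorem IsCov.hasCov {U : Opens N} {φ : ∀ x, H x}
    {D : CVect (E := E) (⊤ : Opens N) → ∀ x, H x} (h : S.IsCov U φ D) :
    S.HasCov U (fun x => φ x) (fun X x => D (X.extend x) x) := by
  have h0 := h.extend_eventuallyEq
  obtain ⟨s, hs⟩ := h
  refine ⟨s, (secTendsto_iff_lTendsto (t := fun j => (s j).1) (fun _ _ => rfl) fun _ => rfl).2
    fun x hx => (hs x hx).1, fun X => secTendsto_iff.2 fun x => ?_⟩
  refine (lTendsto_iff_of_eventuallyEq (t := fun j => S.covF (s j) (X.extend x))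
    (s := fun j => S.covOn U X (s j)) (φ := fun x => D (X.extend x) x) ?_).1
    ((hs x x.2).2 (X.extend x))
  filter_upwards [covOn_eventuallyEq (S := S) X x, h0 X x] with y hy hy'
  exact ⟨fun j => hy (s j), hy'⟩

theorem mem_gammaN_iff [SecondCountableTopology N] (U : Opens N) (φ : ∀ x, H x) (n : ℕ) :
    (fun x : U => φ x) ∈ S.GammaN U n ↔ φ ∈ S.DiffOn U n := by
  classical
  have key : ∀ {φ : ∀ x, H x} {D : CVect (E := E) U → ∀ x : U, H x},
      S.HasCov U (fun x => φ x) D → ∃ D', S.IsCov U φ D' ∧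
        ∀ X (x : U), D' X x = D (X.restrict U) x := by
    intro φ D hD
    let D' : CVect (E := E) (⊤ : Opens N) → ∀ y, H y := fun X y =>
      if h : y ∈ U then D (X.restrict U) ⟨y, h⟩ else 0
    have h0 : ∀ X (x : U), D' X x = D (X.restrict U) x := fun X x => by simp [D']
    exact ⟨D', hD.isCov h0, h0⟩
  induction n using Nat.twoStepInduction generalizing φ with
  | zero =>
    exact exists_congr fun s => secTendsto_iff_lTendsto (t := fun j => (s j).1) (fun _ _ => rfl)
      fun _ => rfl
  | one =>
    constructor
    · rintro ⟨D, hD⟩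
      obtain ⟨D', hD', -⟩ := key hD
      exact ⟨D', hD'⟩
    · rintro ⟨D, hD⟩
      exact ⟨_, hD.hasCov⟩
  | more n _ ih =>
    constructor
    · rintro ⟨h1, D, hD, h2⟩
      obtain ⟨D', hD', h3⟩ := key hD
      refine ⟨(ih φ).1 h1, D', hD', fun X => (ih _).1 ?_⟩
      rw [funext (h3 X)]
      exact h2 _
    · rintro ⟨h1, D, hD, h2⟩
      refine ⟨(ih φ).2 h1, _, hD.hasCov, fun X => ?_⟩
      -- Near `x` the section `ψ` coincides with `D (X.extend x)`, so its differentiability follows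
      -- by locality.
      let ψ : ∀ y, H y := fun y => if h : y ∈ U then D (X.extend ⟨y, h⟩) y else 0
      have hψ : ∀ x : U, ψ x = D (X.extend x) x := fun x => by simp [ψ]
      have h3 : ψ ∈ S.DiffOn U (n + 1) := by
        refine DiffOn.of_local U.isOpen fun x hx => ?_
        obtain ⟨V, hV, hVo, hxV⟩ := eventually_nhds_iff.1 (hD.extend_eventuallyEq X ⟨x, hx⟩)
        refine ⟨Subtype.val '' V, U.isOpenEmbedding'.isOpenMap V hVo, ⟨_, hxV, rfl⟩,
          DiffOn.congr (DiffOn.mono (h2 (X.extend ⟨x, hx⟩)) ?_)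
            (U.isOpenEmbedding'.isOpenMap V hVo) ?_⟩
        · rintro _ ⟨y, -, rfl⟩
          exact y.2
        · rintro _ ⟨y, hy, rfl⟩
          rw [hψ, hV y hy]
      have h4 := (ih ψ).2 h3
      rwa [funext hψ] at h4

theorem mem_gammaInf_iff [SecondCountableTopology N] (U : Opens N) (φ : ∀ x, H x) :
    (fun x : U => φ x) ∈ S.GammaInf U ↔ ∀ n, φ ∈ S.DiffOn U n :=
  mem_iInter.trans (forall_congr' fun n => mem_gammaN_iff U φ n)

theorem mem_gammaInfGlobal_iff [SecondCountableTopology N] (φ : ∀ x, H x) :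
    φ ∈ S.GammaInfGlobal ↔ ∀ n, φ ∈ S.DiffOn univ n :=
  mem_gammaInf_iff ⊤ φ

/-- Infinitely differentiable sections have infinitely differentiable covariant derivatives. -/
theorem exists_isCov_of_forall_diffOn {U : Set N} (hU : IsOpen U) {φ : ∀ x, H x}
    (h : ∀ n, φ ∈ S.DiffOn U n) :
    ∃ D, S.IsCov U φ D ∧ ∀ X n, D X ∈ S.DiffOn U n := by
  obtain ⟨D, hD⟩ := h 1
  -- The derivatives supplied at each order could depend on the order; uniqueness identifies them
  -- all with `D`.
  have h1 : ∀ X n, D X ∈ S.DiffOn U (n + 1) := fun X n => by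
    obtain ⟨-, D', hD', h2⟩ := h (n + 2)
    exact DiffOn.congr (h2 X) hU fun y hy =>
      hD'.unique hD hU hU hy hy (Eventually.of_forall fun _ => rfl) X
  have h0 : ∀ {ψ : ∀ x, H x}, ψ ∈ S.DiffOn U 1 → ψ ∈ S.DiffOn U 0 := by
    rintro ψ ⟨D, s, hs⟩
    exact ⟨s, fun x hx => (hs x hx).1⟩
  refine ⟨D, hD, fun X n => ?_⟩
  cases n with
  | zero => exact h0 (h1 X 0)
  | succ n => exact h1 X n

end SmoothField

end Comparison

/-! ### Strongly smooth operator families are smooth in norm -/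

section StrongSmoothness

variable {E F G : Type*} [NormedAddCommGroup E] [NormedSpace ℝ E]
  [NormedAddCommGroup F] [NormedSpace ℝ F] [NormedAddCommGroup G] [NormedSpace ℝ G]

omit [NormedAddCommGroup E] [NormedSpace ℝ E] in
/-- The uniform boundedness principle for a weighted family of operators. -/
theorem exists_norm_le_mul_of_pointwise [CompleteSpace F] {K : Set E} {R : E → F →L[ℝ] G}
    {ρ : E → ℝ} (hρ : ∀ y, 0 ≤ ρ y) (h0 : ∀ y ∈ K, ρ y = 0 → R y = 0)
    (h : ∀ v, ∃ C, ∀ y ∈ K, ‖R y v‖ ≤ C * ρ y) : ∃ C, ∀ y ∈ K, ‖R y‖ ≤ C * ρ y := by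
  -- Points with `ρ y = 0` are excluded in order to divide by the weight; there `R y` vanishes
  -- anyway.
  obtain ⟨C, hC⟩ := banach_steinhaus (g := fun y : {y // y ∈ K ∧ 0 < ρ y} => (ρ y)⁻¹ • R y) (by
    intro v
    obtain ⟨C, hC⟩ := h v
    refine ⟨C, fun y => ?_⟩
    rw [smul_apply, norm_smul, norm_inv, Real.norm_of_nonneg (hρ y),
      inv_mul_le_iff₀ y.2.2, mul_comm]
    exact hC y y.2.1)
  refine ⟨C, fun y hy => ?_⟩
  rcases (hρ y).eq_or_lt' with h1 | h1
  · rw [h0 y hy h1, h1, norm_zero, mul_zero]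
  · have := hC ⟨y, hy, h1⟩
    rwa [norm_smul, norm_inv, Real.norm_of_nonneg (hρ y), inv_mul_le_iff₀ h1, mul_comm] at this

/-- The derivative is Lipschitz on the compact convex ball. The mean value inequality on the smaller
ball of radius `‖y - x‖` supplies the second factor `‖y - x‖`. -/
theorem exists_taylor_bound [FiniteDimensional ℝ E] {f : E → G} {W : Set E} (hW : IsOpen W)
    (hf : ContDiffOn ℝ ∞ f W) {x : E} {r : ℝ} (hr : Metric.closedBall x r ⊆ W) :
    ∃ C, ∀ y ∈ Metric.closedBall x r, ‖f y - f x - fderiv ℝ f x (y - x)‖ ≤ C * ‖y - x‖ ^ 2 := by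
  have h1 : ContDiffOn ℝ 1 (fderiv ℝ f) (Metric.closedBall x r) :=
    (hf.fderiv_of_isOpen hW (by norm_cast)).mono hr
  have := FiniteDimensional.proper ℝ E
  obtain ⟨K, hK⟩ := h1.exists_lipschitzOnWith (by simp) (convex_closedBall x r)
    (isCompact_closedBall x r)
  refine ⟨K, fun y hy => ?_⟩
  have hsub : Metric.closedBall x ‖y - x‖ ⊆ Metric.closedBall x r :=
    Metric.closedBall_subset_closedBall (by simpa [dist_eq_norm] using hy)
  have h2 := Convex.norm_image_sub_le_of_norm_hasFDerivWithin_le' (f := f) (f' := fderiv ℝ f)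
    (C := K * ‖y - x‖) (s := Metric.closedBall x ‖y - x‖) (x := x) (y := y)
    (φ := fderiv ℝ f x)
    (fun z hz => ((hf.differentiableOn (by simp)).differentiableAt
      (hW.mem_nhds (hr (hsub hz)))).hasFDerivAt.hasFDerivWithinAt)
    (fun z hz => ?_) (convex_closedBall _ _) (Metric.mem_closedBall_self (norm_nonneg _))
    (by simp [dist_eq_norm])
  · rw [sq, ← mul_assoc]
    exact h2
  · have h3 := hK.norm_sub_le (hsub hz)
      (hsub (Metric.mem_closedBall_self (norm_nonneg _)))
    refine h3.trans (mul_le_mul_of_nonneg_left ?_ K.2)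
    rwa [Metric.mem_closedBall, dist_eq_norm] at hz

/-- Uniform boundedness is used twice: with weight `‖y - x‖` it bounds the pointwise derivatives by
one operator `L`, and with weight `‖y - x‖ ^ 2` it makes the Taylor remainder small in operator
norm. -/
theorem differentiableAt_of_strongly [FiniteDimensional ℝ E] [CompleteSpace F]
    {A : E → F →L[ℝ] G} {W : Set E} (hW : IsOpen W)
    (hA : ∀ v, ContDiffOn ℝ ∞ (fun x => A x v) W) {x : E} (hx : x ∈ W) :
    DifferentiableAt ℝ A x := by
  obtain ⟨r, hr0, hr⟩ := Metric.nhds_basis_closedBall.mem_iff.1 (hW.mem_nhds hx)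
  have hd : ∀ v, DifferentiableAt ℝ (fun x => A x v) x := fun v =>
    ((hA v).differentiableOn (by simp)).differentiableAt (hW.mem_nhds hx)
  choose C hC using fun v => exists_taylor_bound hW (hA v) hr
  obtain ⟨K, hK⟩ := exists_norm_le_mul_of_pointwise (K := Metric.closedBall x r)
    (R := fun y => A y - A x) (ρ := fun y => ‖y - x‖) (fun _ => norm_nonneg _)
    (fun y _ h => by rw [sub_eq_zero.1 (norm_eq_zero.1 h), sub_self]) (fun v => by
      refine ⟨|C v| * r + ‖fderiv ℝ (fun x => A x v) x‖, fun y hy => ?_⟩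
      have h1 := hC v y hy
      have h2 := (fderiv ℝ (fun x => A x v) x).le_opNorm (y - x)
      have h3 : ‖y - x‖ ≤ r := by simpa [dist_eq_norm] using hy
      have h4 : C v * ‖y - x‖ ^ 2 ≤ |C v| * r * ‖y - x‖ := by
        rw [sq, ← mul_assoc]
        refine mul_le_mul_of_nonneg_right ?_ (norm_nonneg _)
        exact mul_le_mul (le_abs_self _) h3 (norm_nonneg _) (abs_nonneg _)
      have h5 := norm_add_le (A y v - A x v - fderiv ℝ (fun x => A x v) x (y - x))
        (fderiv ℝ (fun x => A x v) x (y - x))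
      rw [sub_add_cancel] at h5
      rw [sub_apply, add_mul]
      linarith)
  let L : E →L[ℝ] F →L[ℝ] G := LinearMap.mkContinuous₂
    (LinearMap.mk₂ ℝ (fun e v => fderiv ℝ (fun x => A x v) x e)
      (fun e e' v => map_add _ _ _) (fun c e v => map_smul _ _ _)
      (fun e v w => by
        have : (fun x => A x (v + w)) = (fun x => A x v) + fun x => A x w := by
          funext y
          exact map_add _ _ _
        rw [this, fderiv_add (hd v) (hd w)]
        rfl)
      (fun c e v => by
        have : (fun x => A x (c • v)) = c • fun x => A x v := by
          funext y
          exact map_smul _ _ _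
        rw [this, fderiv_const_smul (hd v)]
        rfl)) |K| (fun e v => by
      have h1 : ‖fderiv ℝ (fun x => A x v) x‖ ≤ |K| * ‖v‖ := by
        refine (hd v).hasFDerivAt.le_of_lip' (by positivity) ?_
        filter_upwards [Metric.closedBall_mem_nhds x hr0] with y hy
        have h2 := (A y - A x).le_opNorm v
        rw [sub_apply] at h2
        refine h2.trans ?_
        have h3 := (hK y hy).trans (mul_le_mul_of_nonneg_right (le_abs_self K) (norm_nonneg _))
        calc _ ≤ |K| * ‖y - x‖ * ‖v‖ := mul_le_mul_of_nonneg_right h3 (norm_nonneg _)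
          _ = _ := by ring
      calc _ ≤ |K| * ‖v‖ * ‖e‖ :=
            ((fderiv ℝ (fun x => A x v) x).le_opNorm e).trans
              (mul_le_mul_of_nonneg_right h1 (norm_nonneg _))
        _ = _ := by ring)
  have hL : ∀ e v, L e v = fderiv ℝ (fun x => A x v) x e := fun e v => rfl
  obtain ⟨M, hM⟩ := exists_norm_le_mul_of_pointwise (K := Metric.closedBall x r)
    (R := fun y => A y - A x - L (y - x)) (ρ := fun y => ‖y - x‖ ^ 2) (fun _ => sq_nonneg _)
    (fun y _ h => by
      have : y = x := by simpa [sub_eq_zero] using h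
      simp [this]) (fun v => ⟨C v, fun y hy => hC v y hy⟩)
  have h1 : HasFDerivAt (fun y => A y - A x - L (y - x)) (0 : E →L[ℝ] F →L[ℝ] G) x := by
    refine Asymptotics.IsBigO.hasFDerivAt (n := 2) ?_ one_lt_two
    refine Asymptotics.IsBigO.of_bound M ?_
    filter_upwards [Metric.closedBall_mem_nhds x hr0] with y hy
    rw [norm_pow, norm_norm]
    exact hM y hy
  have h2 : A = fun y => (A y - A x - L (y - x)) + (A x + L (y - x)) := by
    funext y
    abel
  rw [h2]
  exact h1.differentiableAt.add ((differentiableAt_const _).add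
    (L.differentiableAt.comp x (differentiableAt_id.sub_const x)))

/-- A strongly smooth family of operators on a finite-dimensional space of parameters is smooth
in the operator norm. -/
theorem contDiffOn_of_strongly [FiniteDimensional ℝ E] [CompleteSpace F]
    {A : E → F →L[ℝ] G} {W : Set E} (hW : IsOpen W)
    (hA : ∀ v, ContDiffOn ℝ ∞ (fun x => A x v) W) : ContDiffOn ℝ ∞ A W := by
  rw [contDiffOn_infty]
  intro n
  induction n generalizing A with
  | zero =>
    exact contDiffOn_zero.2 fun x hx =>
      (differentiableAt_of_strongly hW hA hx).continuousAt.continuousWithinAt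
  | succ n ih =>
    have hd := fun x hx => differentiableAt_of_strongly hW hA (x := x) hx
    rw [Nat.cast_add, Nat.cast_one, contDiffOn_succ_iff_fderiv_of_isOpen hW]
    -- As `E` is finite-dimensional, the derivative may be tested on each direction `e`; the family
    -- obtained is again strongly smooth, so the induction applies to it.
    refine ⟨fun x hx => (hd x hx).differentiableWithinAt, by simp, contDiffOn_clm_apply.2 fun e => ?_⟩
    refine ih fun v => ?_
    have h1 : ContDiffOn ℝ ∞ (fderiv ℝ (fun x => A x v)) W :=
      (hA v).fderiv_of_isOpen hW (by norm_cast)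
    refine (h1.clm_apply contDiffOn_const : ContDiffOn ℝ ∞
      (fun x => fderiv ℝ (fun x => A x v) x e) W).congr fun x hx => ?_
    have h2 := ((ContinuousLinearMap.apply ℝ G v).hasFDerivAt.comp x (hd x hx).hasFDerivAt).fderiv
    exact (congrArg (fun L : E →L[ℝ] G => L e) h2).symm

theorem contMDiffOn_of_strongly [FiniteDimensional ℝ E] [CompleteSpace F]
    {N : Type*} [TopologicalSpace N] [ChartedSpace E N] [IsManifold 𝓘(ℝ, E) ∞ N]
    {A : N → F →L[ℝ] G} {W : Set N} (hW : IsOpen W)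
    (hA : ∀ v, ContMDiffOn 𝓘(ℝ, E) 𝓘(ℝ, G) ∞ (fun x => A x v) W) :
    ContMDiffOn 𝓘(ℝ, E) 𝓘(ℝ, F →L[ℝ] G) ∞ A W := by
  intro x hx
  refine ContMDiffAt.contMDiffWithinAt ?_
  let e := extChartAt 𝓘(ℝ, E) x
  have hW' : IsOpen (e.target ∩ e.symm ⁻¹' W) :=
    (continuousOn_extChartAt_symm x).isOpen_inter_preimage (isOpen_extChartAt_target x) hW
  have h1 : ContDiffOn ℝ ∞ (A ∘ e.symm) (e.target ∩ e.symm ⁻¹' W) := by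
    refine contDiffOn_of_strongly hW' fun v => ?_
    rw [← contMDiffOn_iff_contDiffOn]
    exact (hA v).comp ((contMDiffOn_extChartAt_symm x).mono inter_subset_left) fun z hz => hz.2
  have hex : e x ∈ e.target ∩ e.symm ⁻¹' W :=
    ⟨mem_extChartAt_target x, by rwa [mem_preimage, extChartAt_to_inv x]⟩
  have h2 : ContMDiffAt 𝓘(ℝ, E) 𝓘(ℝ, F →L[ℝ] G) ∞ (A ∘ e.symm) (e x) :=
    ((h1 _ hex).contDiffAt (hW'.mem_nhds hex)).contMDiffAt
  refine (h2.comp x contMDiffAt_extChartAt).congr_of_eventuallyEq ?_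
  filter_upwards [extChartAt_source_mem_nhds (I := 𝓘(ℝ, E)) x] with y hy
  simp [e.left_inv hy]

end StrongSmoothness

/-! ### Smooth maps into a Banach manifold -/

section SmoothInto

namespace BanachManifold

variable {M : Type uN} {B : BanachManifold.{uN, v} M}
  {F : Type*} [NormedAddCommGroup F] [NormedSpace ℝ F]
  {K : Type*} [TopologicalSpace K] {J : ModelWithCorners ℝ F K}
  {P : Type*} [TopologicalSpace P] [ChartedSpace K P]
  {F' : Type*} [NormedAddCommGroup F'] [NormedSpace ℝ F']
  {K' : Type*} [TopologicalSpace K'] {J' : ModelWithCorners ℝ F' K'}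
  {P' : Type*} [TopologicalSpace P'] [ChartedSpace K' P']

theorem SmoothInto.comp {g : P → M} (hg : B.SmoothInto J g) {f : P' → P}
    (hf : ContMDiff J' J ∞ f) : B.SmoothInto J' (fun y => g (f y)) := by
  let _ := B.top
  exact ⟨hg.1.comp hf.continuous, fun c hc => (hg.2 c hc).comp hf.contMDiffOn fun _ h => h⟩

theorem SmoothInto.of_cover {ι : Type*} {U : ι → Opens P} (hU : ∀ x, ∃ i, x ∈ U i) {g : P → M}
    (h : ∀ i, B.SmoothInto J (fun x : U i => g x)) : B.SmoothInto J g := by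
  let _ := B.top
  refine ⟨continuous_iff_continuousAt.2 fun x => ?_, fun c hc x hx => ?_⟩
  · obtain ⟨i, hi⟩ := hU x
    exact ((U i).isOpenEmbedding'.continuousAt_iff (x := ⟨x, hi⟩)).1 (h i).1.continuousAt
  · obtain ⟨i, hi⟩ := hU x
    refine ContMDiffAt.contMDiffWithinAt ?_
    refine (contMDiffAt_subtype_iff (U := U i) (x := ⟨x, hi⟩)).1 ?_
    exact ((h i).2 c hc).contMDiffAt ((c.chart.open_source.preimage (h i).1).mem_nhds hx)

end BanachManifold

end SmoothInto

/-! ### Smooth sections read in the trivializations -/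

section Bundles

variable {E : Type uE} [NormedAddCommGroup E] [NormedSpace ℝ E]
  {N : Type uN} [TopologicalSpace N] [ChartedSpace E N]
  {H : N → Type uH} [∀ x, NormedAddCommGroup (H x)] [∀ x, InnerProductSpace ℂ (H x)]
  {ι : Type uI} {F : ι → Type uF} [∀ i, NormedAddCommGroup (F i)]
  [∀ i, InnerProductSpace ℂ (F i)]
  {B : BanachManifold.{max uN uH, v} (TotalField H)}
  {U : ι → Opens N} {T : ∀ i, ∀ x : U i, H x ≃ₗᵢ[ℂ] F i}

omit [ChartedSpace E N] in
theorem trivInv_trivMap (i : ι) (m : {m : TotalField H | m.base ∈ U i}) :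
    trivInv U T i (trivMap U T i m) = m.1 :=
  congrArg (TotalField.mk m.1.base)
    (LinearIsometryEquiv.symm_apply_apply (T i ⟨m.1.base, m.2⟩) m.1.vec)

namespace IsHilbertBundle

/-- A section and its local representative differ by composition with the trivialization or its
inverse, both smooth; in one direction the composition passes through a chart of the total space. -/
theorem mem_smoothSec_iff (hB : IsHilbertBundle E B U T) (i : ι) (φ : ∀ x : U i, H x) :
    φ ∈ smoothSec E B (U i) ↔ ContMDiff 𝓘(ℝ, E) 𝓘(ℝ, F i) ∞ fun x => T i x (φ x) := by
  classical
  let _ := B.top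
  constructor
  · intro hφ x₀
    have hφ' : B.SmoothInto 𝓘(ℝ, E) (fun x : U i => (⟨x, φ x⟩ : TotalField H)) := hφ
    let σ : U i → TotalField H := fun x => ⟨x, φ x⟩
    obtain ⟨c, hc, hm⟩ := B.cover (σ x₀)
    let O : Opens c.V := ⟨c.chart.target ∩ c.chart.symm ⁻¹' {m | m.base ∈ U i},
      c.chart.isOpen_inter_preimage_symm ((U i).isOpen.preimage hB.continuous_proj)⟩
    have h1 := hB.smooth_triv i c hc O fun z hz => hz
    -- The extension by zero makes the trivialization a function on the whole model space; only its
    -- germ at a point of `O` matters.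
    let f : c.V → F i := fun z => if h : z ∈ O then
      (trivMap U T i ⟨c.chart.symm z, h.2⟩).2 else 0
    have hσO : ∀ x, σ x ∈ c.chart.source → c.chart (σ x) ∈ O := by
      intro x hx
      refine ⟨c.chart.map_source hx, ?_⟩
      rw [mem_preimage, c.chart.left_inv hx]
      exact x.2
    have h2 : ContMDiffAt 𝓘(ℝ, c.V) 𝓘(ℝ, F i) ∞ f (c.chart (σ x₀)) := by
      refine (contMDiffAt_subtype_iff (U := O) (x := ⟨_, hσO x₀ hm⟩)).1 ?_
      refine (contMDiff_snd.comp h1).contMDiffAt.congr_of_eventuallyEq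
        (Eventually.of_forall fun z => ?_)
      simp [f]
    have hopen := c.chart.open_source.preimage hφ'.1
    have h3 := (hφ'.2 c hc).contMDiffAt (hopen.mem_nhds hm)
    refine (h2.comp x₀ h3).congr_of_eventuallyEq ?_
    filter_upwards [hopen.mem_nhds hm] with x hx
    have h4 : f (c.chart (σ x)) =
        (trivMap U T i ⟨c.chart.symm (c.chart (σ x)), (hσO x hx).2⟩).2 := dif_pos (hσO x hx)
    have h5 : (⟨c.chart.symm (c.chart (σ x)), (hσO x hx).2⟩ : {m : TotalField H | m.base ∈ U i}) =
        ⟨σ x, x.2⟩ := Subtype.ext (c.chart.left_inv hx)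
    rw [h5] at h4
    exact h4.symm
  · intro h
    have h1 := (hB.smooth_inv i).comp (contMDiff_id.prodMk h)
    simp only [id_eq, trivInv, LinearIsometryEquiv.symm_apply_apply] at h1
    exact h1

theorem mem_smoothSecGlobal_iff (hU : ∀ x : N, ∃ i, x ∈ U i) (hB : IsHilbertBundle E B U T)
    (φ : ∀ x, H x) : φ ∈ smoothSecGlobal E B ↔
      ∀ i, ContMDiff 𝓘(ℝ, E) 𝓘(ℝ, F i) ∞ fun x : U i => T i x (φ x) := by
  constructor
  · intro h i
    exact (hB.mem_smoothSec_iff i fun x => φ x).1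
      (BanachManifold.SmoothInto.comp (g := fun x : N => (⟨x, φ x⟩ : TotalField H)) h
        (contMDiff_subtype_val (U := U i)))
  · intro h
    exact BanachManifold.SmoothInto.of_cover hU fun i => (hB.mem_smoothSec_iff i fun x => φ x).2 (h i)

end IsHilbertBundle

end Bundles

/-! ### Transition operators -/

section Construction

variable {E : Type uE} [NormedAddCommGroup E] [NormedSpace ℝ E]
  {N : Type uN} [TopologicalSpace N] [ChartedSpace E N]
  {H : N → Type uH} [∀ x, NormedAddCommGroup (H x)] [∀ x, InnerProductSpace ℂ (H x)]
  {ι : Type uI} {F : ι → Type uF} [∀ i, NormedAddCommGroup (F i)]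
  [∀ i, InnerProductSpace ℂ (F i)]
  (U : ι → Opens N) (T : ∀ i, ∀ x : U i, H x ≃ₗᵢ[ℂ] F i)

open Classical in
/-- The transition operators `T_j(x) T_i(x)⁻¹`, extended by zero. -/
def transition (i j : ι) (x : N) : F i →L[ℝ] F j :=
  if h : x ∈ U i ∧ x ∈ U j then
    ((((T i ⟨x, h.1⟩).symm.trans (T j ⟨x, h.2⟩)).toContinuousLinearEquiv :
      F i →L[ℂ] F j)).restrictScalars ℝ
  else 0

variable {U T}

omit [ChartedSpace E N] in
theorem transition_apply {i j : ι} {x : N} (hi : x ∈ U i) (hj : x ∈ U j) (v : F i) :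
    transition U T i j x v = T j ⟨x, hj⟩ ((T i ⟨x, hi⟩).symm v) := by
  rw [transition, dif_pos ⟨hi, hj⟩]
  rfl

omit [ChartedSpace E N] in
theorem trivInv_eq_trivInv_iff {i j : ι} (p : U i × F i) (q : U j × F j) :
    trivInv U T j q = trivInv U T i p ↔
      (q.1 : N) = p.1 ∧ q.2 = transition U T i j p.1 p.2 := by
  obtain ⟨⟨x, hx⟩, v⟩ := p
  obtain ⟨⟨y, hy⟩, w⟩ := q
  simp only [trivInv, TotalField.mk.injEq]
  constructor
  · rintro ⟨rfl, h⟩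
    rw [transition_apply hx hy, ← eq_of_heq h]
    simp
  · rintro ⟨rfl, rfl⟩
    rw [transition_apply hx hy]
    simp

/-- The transition operators are strongly smooth. -/
def StronglySmoothTransitions (E : Type uE) [NormedAddCommGroup E] [NormedSpace ℝ E]
    {N : Type uN} [TopologicalSpace N] [ChartedSpace E N]
    {H : N → Type uH} [∀ x, NormedAddCommGroup (H x)] [∀ x, InnerProductSpace ℂ (H x)]
    {ι : Type uI} {F : ι → Type uF} [∀ i, NormedAddCommGroup (F i)]
    [∀ i, InnerProductSpace ℂ (F i)]
    (U : ι → Opens N) (T : ∀ i, ∀ x : U i, H x ≃ₗᵢ[ℂ] F i) : Prop :=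
  ∀ i j (v : F i), ContMDiffOn 𝓘(ℝ, E) 𝓘(ℝ, F j) ∞ (fun x => transition U T i j x v)
    (U i ∩ U j : Set N)

variable [FiniteDimensional ℝ E] [IsManifold 𝓘(ℝ, E) ∞ N] [∀ i, CompleteSpace (F i)]

theorem StronglySmoothTransitions.contMDiffOn (hT : StronglySmoothTransitions E U T) (i j : ι) :
    ContMDiffOn (𝓘(ℝ, E).prod 𝓘(ℝ, F i)) 𝓘(ℝ, F j) ∞
      (fun q : N × F i => transition U T i j q.1 q.2) ((U i ∩ U j : Set N) ×ˢ univ) := by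
  have h1 := contMDiffOn_of_strongly ((U i).isOpen.inter (U j).isOpen) (hT i j)
  exact (h1.comp contMDiffOn_fst fun q hq => hq.1).clm_apply contMDiffOn_snd

/-- A map into a local trivialization is smooth if it is so in another trivialization. -/
theorem StronglySmoothTransitions.contMDiffOn_of_trivInv_eq
    (hT : StronglySmoothTransitions E U T) {i j : ι}
    {G : Type*} [NormedAddCommGroup G] [NormedSpace ℝ G]
    {K : Type*} [TopologicalSpace K] {J : ModelWithCorners ℝ G K}
    {P : Type*} [TopologicalSpace P] [ChartedSpace K P] {W : Set P}
    {r : P → U i × F i} {t : P → U j × F j}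
    (hr : ContMDiffOn J (𝓘(ℝ, E).prod 𝓘(ℝ, F i)) ∞ r W)
    (h : ∀ z ∈ W, trivInv U T j (t z) = trivInv U T i (r z)) :
    ContMDiffOn J (𝓘(ℝ, E).prod 𝓘(ℝ, F j)) ∞ t W := by
  have h' := fun z hz => (trivInv_eq_trivInv_iff (r z) (t z)).1 (h z hz)
  have hr1 : ContMDiffOn J 𝓘(ℝ, E) ∞ (fun z => ((r z).1 : N)) W :=
    contMDiff_subtype_val.comp_contMDiffOn (contMDiff_fst.comp_contMDiffOn hr)
  have hr2 : ContMDiffOn J 𝓘(ℝ, F i) ∞ (fun z => (r z).2) W := contMDiff_snd.comp_contMDiffOn hr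
  have h1 : ContMDiffOn J 𝓘(ℝ, E) ∞ (fun z => (t z).1) W := by
    intro z hz
    rw [← ContMDiffWithinAt.subtypeVal_comp_iff]
    exact (hr1.congr fun z hz => (h' z hz).1) z hz
  have h2 : ContMDiffOn J 𝓘(ℝ, F j) ∞ (fun z => (t z).2) W := by
    refine ((hT.contMDiffOn i j).comp (hr1.prodMk hr2) ?_).congr fun z hz => (h' z hz).2
    intro z hz
    refine ⟨⟨(r z).1.2, ?_⟩, trivial⟩
    change ((r z).1 : N) ∈ U j
    rw [← (h' z hz).1]
    exact (t z).1.2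
  exact h1.prodMk h2

end Construction

/-! ### The bundle glued from the trivializations -/

section Construction

variable {E : Type uE} [NormedAddCommGroup E] [NormedSpace ℝ E]
  {N : Type uN} [TopologicalSpace N] [ChartedSpace E N]
  {H : N → Type uH} [∀ x, NormedAddCommGroup (H x)] [∀ x, InnerProductSpace ℂ (H x)]
  {ι : Type uI} {F : ι → Type uF} [∀ i, NormedAddCommGroup (F i)]
  [∀ i, InnerProductSpace ℂ (F i)]
  (U : ι → Opens N) (T : ∀ i, ∀ x : U i, H x ≃ₗᵢ[ℂ] F i)

/-- The topology on the total space coinduced by the local trivializations. -/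
@[reducible]
def totalTopology : TopologicalSpace (TotalField H) :=
  ⨆ i, coinduced (trivInv U T i) inferInstance

variable {U T}

omit [ChartedSpace E N] in
theorem isOpen_totalTopology_iff {s : Set (TotalField H)} :
    IsOpen[totalTopology U T] s ↔ ∀ i, IsOpen (trivInv U T i ⁻¹' s) := by
  simp only [isOpen_iSup_iff, isOpen_coinduced]

omit [ChartedSpace E N] in
theorem trivInv_injective (i : ι) : Function.Injective (trivInv U T i) := by
  intro p q h
  have h1 := (trivInv_eq_trivInv_iff q p).1 h
  have h2 : p.1 = q.1 := Subtype.ext h1.1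
  refine Prod.ext h2 ?_
  rw [h1.2, transition_apply q.1.2 q.1.2]
  simp

variable [FiniteDimensional ℝ E] [IsManifold 𝓘(ℝ, E) ∞ N] [∀ i, CompleteSpace (F i)]

/-- Seen in the trivialization `j`, the image of an open set is its preimage under the change of
trivialization, which is jointly continuous thanks to norm smoothness of the transition operators.
-/
theorem isOpenEmbedding_trivInv (hT : StronglySmoothTransitions E U T) (i : ι) :
    let _ := totalTopology U T
    Topology.IsOpenEmbedding (trivInv U T i) := by
  let _ := totalTopology U T
  refine Topology.IsOpenEmbedding.of_continuous_injective_isOpenMap ?_ (trivInv_injective i) ?_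
  · exact continuous_def.2 fun s hs => isOpen_totalTopology_iff.1 hs i
  · intro O hO
    refine isOpen_totalTopology_iff.2 fun j => ?_
    -- The base points of the two trivializations lie in different subtypes, so they are compared in
    -- `N`.
    have hemb : Topology.IsOpenEmbedding (fun q : U i × F i => ((q.1 : N), q.2)) :=
      (U i).isOpenEmbedding'.prodMap Topology.IsOpenEmbedding.id
    have hc : ContinuousOn (fun q : U j × F j => ((q.1 : N), transition U T j i q.1 q.2))
        {q | (q.1 : N) ∈ U i} := by
      refine ContinuousOn.prodMk (by fun_prop) ?_
      refine (hT.contMDiffOn j i).continuousOn.comp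
        (f := fun q : U j × F j => ((q.1 : N), q.2)) (by fun_prop) ?_
      exact fun q hq => ⟨⟨q.1.2, hq⟩, trivial⟩
    have hopen : IsOpen {q : U j × F j | (q.1 : N) ∈ U i} :=
      (U i).isOpen.preimage (continuous_subtype_val.comp continuous_fst)
    convert! hc.isOpen_inter_preimage hopen (hemb.isOpenMap O hO) using 1
    ext q
    simp only [mem_preimage, mem_image, mem_inter_iff, mem_ofPred_eq]
    constructor
    · rintro ⟨p, hp, hpq⟩
      have h1 := (trivInv_eq_trivInv_iff q p).1 hpq
      refine ⟨h1.1 ▸ p.1.2, p, hp, Prod.ext h1.1 h1.2⟩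
    · rintro ⟨-, p, hp, hpq⟩
      refine ⟨p, hp, (trivInv_eq_trivInv_iff q p).2 ?_⟩
      exact ⟨congrArg Prod.fst hpq, congrArg Prod.snd hpq⟩

/-- The local trivialization as a partial homeomorphism. -/
def trivPartialHomeomorph (hT : StronglySmoothTransitions E U T) (i : ι) [Nonempty (U i × F i)] :
    let _ := totalTopology U T
    OpenPartialHomeomorph (U i × F i) (TotalField H) :=
  let _ := totalTopology U T
  (isOpenEmbedding_trivInv hT i).toOpenPartialHomeomorph _

/-- The chart of a local trivialization given by a chart of the base. -/
def prodChart {V : Opens N} {G : Type*} [NormedAddCommGroup G] (q : V × G) :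
    OpenPartialHomeomorph (V × G) (E × G) :=
  (chartAt E q.1).prod (OpenPartialHomeomorph.refl G)

omit [NormedSpace ℝ E] [FiniteDimensional ℝ E] [IsManifold 𝓘(ℝ, E) ∞ N] in
theorem mem_prodChart_source {V : Opens N} {G : Type*} [NormedAddCommGroup G] (q : V × G) :
    q ∈ (prodChart (E := E) q).source :=
  ⟨mem_chart_source E q.1, trivial⟩

omit [FiniteDimensional ℝ E] in
theorem contMDiffOn_prodChart {V : Opens N} {G : Type*} [NormedAddCommGroup G] [NormedSpace ℝ G]
    (q : V × G) : ContMDiffOn (𝓘(ℝ, E).prod 𝓘(ℝ, G)) 𝓘(ℝ, E × G) ∞ (prodChart (E := E) q)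
      (prodChart (E := E) q).source :=
  ((contMDiffOn_chart (I := 𝓘(ℝ, E)) (H := E) (x := q.1)).comp contMDiffOn_fst
    fun _ h => h.1).prodMk_space contMDiffOn_snd

omit [FiniteDimensional ℝ E] in
theorem contMDiffOn_prodChart_symm {V : Opens N} {G : Type*} [NormedAddCommGroup G]
    [NormedSpace ℝ G] (q : V × G) :
    ContMDiffOn 𝓘(ℝ, E × G) (𝓘(ℝ, E).prod 𝓘(ℝ, G)) ∞ (prodChart (E := E) q).symm
      (prodChart (E := E) q).target :=
  ((contMDiffOn_chart_symm (I := 𝓘(ℝ, E)) (H := E) (x := q.1)).comp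
    (contDiff_fst (𝕜 := ℝ) (E := E) (F := G)).contMDiff.contMDiffOn fun _ h => h.1).prodMk
    (contDiff_snd (𝕜 := ℝ) (E := E) (F := G)).contMDiff.contMDiffOn

/-- The chart of the total space at a point of a local trivialization. -/
def bundleChart (hT : StronglySmoothTransitions E U T) (i : ι) (q : U i × F i) :
    let _ := totalTopology U T
    BanachChart.{max uN uH, max uE uF} (TotalField H) :=
  let _ := totalTopology U T
  have : Nonempty (U i × F i) := ⟨q⟩
  have : CompleteSpace E := FiniteDimensional.complete ℝ E
  { V := E × F i
    chart := (trivPartialHomeomorph hT i).symm.trans (prodChart q) }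

section

variable (hT : StronglySmoothTransitions E U T) (i : ι) (q : U i × F i)

/-- The representation of the points of a chart of the total space in the trivialization. -/
def bundleRep : @BanachChart.V _ (totalTopology U T) (bundleChart hT i q) → U i × F i :=
  (prodChart (E := E) q).symm

theorem bundleChart_trivInv (p : U i × F i) :
    let _ := totalTopology U T
    (bundleChart hT i q).chart (trivInv U T i p) = prodChart q p := by
  let _ := totalTopology U T
  have : Nonempty (U i × F i) := ⟨q⟩
  have h1 : (trivPartialHomeomorph hT i).symm (trivInv U T i p) = p :=
    (trivPartialHomeomorph hT i).left_inv (mem_univ p)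
  exact congrArg (prodChart q) h1

theorem mem_bundleChart_source_iff (m : TotalField H) :
    let _ := totalTopology U T
    m ∈ (bundleChart hT i q).chart.source ↔
      ∃ p ∈ (prodChart (E := E) q).source, trivInv U T i p = m := by
  let _ := totalTopology U T
  have : Nonempty (U i × F i) := ⟨q⟩
  have hinv : ∀ p, (trivPartialHomeomorph hT i).symm (trivInv U T i p) = p := fun p =>
    (trivPartialHomeomorph hT i).left_inv (mem_univ p)
  change m ∈ ((trivPartialHomeomorph hT i).symm.trans (prodChart q)).source ↔ _
  rw [OpenPartialHomeomorph.trans_source]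
  constructor
  · rintro ⟨h1, h2⟩
    exact ⟨_, h2, (trivPartialHomeomorph hT i).right_inv h1⟩
  · rintro ⟨p, hp, rfl⟩
    refine ⟨(trivPartialHomeomorph hT i).map_source (mem_univ p), ?_⟩
    rw [mem_preimage, hinv]
    exact hp

theorem contMDiffOn_bundleRep :
    let _ := totalTopology U T
    ContMDiffOn 𝓘(ℝ, (bundleChart hT i q).V) (𝓘(ℝ, E).prod 𝓘(ℝ, F i)) ∞ (bundleRep hT i q)
      (bundleChart hT i q).chart.target := by
  let _ := totalTopology U T
  have h : (bundleChart hT i q).chart.target ⊆ (prodChart (E := E) q).target := fun _ hz => hz.1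
  exact (contMDiffOn_prodChart_symm (E := E) q).mono h

end

/-- In a chart of the total space, a map into a local trivialization is smooth. -/
theorem contMDiffOn_bundleChart {hT : StronglySmoothTransitions E U T} {i j : ι}
    {p : U j × F j}
    {G : Type*} [NormedAddCommGroup G] [NormedSpace ℝ G]
    {K : Type*} [TopologicalSpace K] {J : ModelWithCorners ℝ G K}
    {P : Type*} [TopologicalSpace P] [ChartedSpace K P] {W : Set P}
    {r : P → U i × F i} (hr : ContMDiffOn J (𝓘(ℝ, E).prod 𝓘(ℝ, F i)) ∞ r W)
    (hW : let _ := totalTopology U T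
      ∀ z ∈ W, trivInv U T i (r z) ∈ (bundleChart hT j p).chart.source) :
    let _ := totalTopology U T
    ContMDiffOn J 𝓘(ℝ, (bundleChart hT j p).V) ∞
      (fun z => (bundleChart hT j p).chart (trivInv U T i (r z))) W := by
  let _ := totalTopology U T
  have : Nonempty (U j × F j) := ⟨p⟩
  have h1 := fun z hz => (mem_bundleChart_source_iff hT j p _).1 (hW z hz)
  -- `t` represents the same points in the trivialization `j`; it is smooth because the change of
  -- trivialization is.
  choose! t ht1 ht2 using h1
  have h2 : ContMDiffOn J (𝓘(ℝ, E).prod 𝓘(ℝ, F j)) ∞ t W := hT.contMDiffOn_of_trivInv_eq hr ht2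
  refine ((contMDiffOn_prodChart (E := E) p).comp h2 ht1).congr fun z hz => ?_
  rw [← ht2 z hz]
  exact bundleChart_trivInv hT j p (t z)

/-- The Banach manifold structure on the total space defined by local trivializations with
strongly smooth transition operators. -/
def bundleManifold (hU : ∀ x : N, ∃ i, x ∈ U i) (hT : StronglySmoothTransitions E U T) :
    BanachManifold.{max uN uH, max uE uF} (TotalField H) :=
  let _ := totalTopology U T
  { atlas := {c | ∃ i q, c = bundleChart hT i q}
    cover := fun m => by
      obtain ⟨i, hi⟩ := hU m.base
      refine ⟨_, ⟨i, trivMap U T i ⟨m, hi⟩, rfl⟩, (mem_bundleChart_source_iff hT i _ m).2 ?_⟩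
      exact ⟨_, mem_prodChart_source _, trivInv_trivMap i ⟨m, hi⟩⟩
    compat := by
      rintro _ ⟨i, q, rfl⟩ _ ⟨j, p, rfl⟩
      -- The inverse of a bundle chart is `trivInv` after `bundleRep`, so the change of charts has
      -- the required form.
      have h2 := contMDiffOn_bundleChart (hT := hT) (j := j) (p := p)
        ((contMDiffOn_bundleRep hT i q).mono fun z hz => hz.1)
        (W := ((bundleChart hT i q).chart.symm.trans (bundleChart hT j p).chart).source)
        fun z hz => hz.2
      exact contMDiffOn_iff_contDiffOn.1 h2 }

theorem isHilbertBundle_bundleManifold (hU : ∀ x : N, ∃ i, x ∈ U i)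
    (hT : StronglySmoothTransitions E U T) :
    IsHilbertBundle E (bundleManifold hU hT) U T where
  continuous_proj := by
    let _ := totalTopology U T
    change Continuous (TotalField.base : TotalField H → N)
    refine continuous_def.2 fun s hs => isOpen_totalTopology_iff.2 fun i => ?_
    exact hs.preimage (continuous_subtype_val.comp continuous_fst)
  smooth_proj := by
    let _ := totalTopology U T
    rintro _ ⟨i, q, rfl⟩ O hO
    have h2 := (contMDiff_subtype_val.comp contMDiff_fst).comp_contMDiffOn
      (contMDiffOn_bundleRep hT i q)
    exact contMDiffOn_univ.1 (h2.comp (contMDiff_subtype_val (U := O)).contMDiffOn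
      fun z _ => (hO z z.2).1)
  smooth_triv := by
    let _ := totalTopology U T
    rintro j _ ⟨i, q, rfl⟩ O hO
    have h2 := (contMDiffOn_bundleRep hT i q).comp (contMDiff_subtype_val (U := O)).contMDiffOn
      (s := univ) fun z _ => (hO z z.2).1
    exact contMDiffOn_univ.1 (hT.contMDiffOn_of_trivInv_eq h2 fun z _ => trivInv_trivMap j _)
  smooth_inv := by
    let _ := totalTopology U T
    intro i
    refine ⟨(isOpenEmbedding_trivInv hT i).continuous, ?_⟩
    rintro _ ⟨j, p, rfl⟩
    exact contMDiffOn_bundleChart contMDiffOn_id fun z hz => hz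

end Construction

/-! ### Smooth fields whose sections are trivialized -/

section SmoothFieldBundles

variable {E : Type uE} [NormedAddCommGroup E] [NormedSpace ℝ E] [FiniteDimensional ℝ E]
  {N : Type uN} [TopologicalSpace N] [T2Space N] [SecondCountableTopology N]
  [ChartedSpace E N] [IsManifold 𝓘(ℝ, E) ∞ N]
  {H : N → Type uH} [∀ x, NormedAddCommGroup (H x)] [∀ x, InnerProductSpace ℂ (H x)]
  {S : SmoothField E H}
  {ι : Type uI} {U : ι → Opens N}
  {F : ι → Type uF} [∀ i, NormedAddCommGroup (F i)] [∀ i, InnerProductSpace ℂ (F i)]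
  {T : ∀ i, ∀ x : U i, H x ≃ₗᵢ[ℂ] F i}

namespace SmoothField

/-- The trivializations identify infinitely differentiable sections with smooth functions. -/
def TrivializesSections (S : SmoothField E H) (U : ι → Opens N)
    (T : ∀ i, ∀ x : U i, H x ≃ₗᵢ[ℂ] F i) : Prop :=
  ∀ i, (fun (φ : ∀ x : U i, H x) (x : U i) => T i x (φ x)) '' S.GammaInf (U i) =
    {f : U i → F i | ContMDiff 𝓘(ℝ, E) 𝓘(ℝ, F i) ∞ f}

omit [SecondCountableTopology N] in
theorem TrivializesSections.mem_gammaInf_iff (h : S.TrivializesSections U T) (i : ι)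
    (φ : ∀ x : U i, H x) :
    φ ∈ S.GammaInf (U i) ↔ ContMDiff 𝓘(ℝ, E) 𝓘(ℝ, F i) ∞ fun x => T i x (φ x) := by
  have hinj : Function.Injective fun (φ : ∀ x : U i, H x) (x : U i) => T i x (φ x) :=
    fun φ ψ h => funext fun x => (T i x).injective (congrFun h x)
  exact (hinj.mem_set_image (s := S.GammaInf (U i))).symm.trans (by rw [h i]; rfl)

theorem TrivializesSections.forall_diffOn_iff (h : S.TrivializesSections U T) (i : ι)
    (φ : ∀ x, H x) : (∀ n, φ ∈ S.DiffOn (U i) n) ↔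
      ContMDiff 𝓘(ℝ, E) 𝓘(ℝ, F i) ∞ fun x : U i => T i x (φ x) :=
  (SmoothField.mem_gammaInf_iff (U i) φ).symm.trans (h.mem_gammaInf_iff i fun x => φ x)

/-- Infinitely differentiable sections on the whole manifold are characterized by the
trivializations. -/
theorem TrivializesSections.mem_gammaInfGlobal_iff (h : S.TrivializesSections U T)
    (hU : ∀ x : N, ∃ i, x ∈ U i) (φ : ∀ x, H x) : φ ∈ S.GammaInfGlobal ↔
      ∀ i, ContMDiff 𝓘(ℝ, E) 𝓘(ℝ, F i) ∞ fun x : U i => T i x (φ x) := by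
  rw [SmoothField.mem_gammaInfGlobal_iff]
  constructor
  · intro hφ i
    exact (h.forall_diffOn_iff i φ).1 fun n => DiffOn.mono (hφ n) (subset_univ _)
  · intro hφ n
    refine DiffOn.of_local isOpen_univ fun x _ => ?_
    obtain ⟨i, hi⟩ := hU x
    exact ⟨U i, (U i).isOpen, hi, (h.forall_diffOn_iff i φ).2 (hφ i) n⟩

theorem TrivializesSections.gammaInfGlobal_eq (h : S.TrivializesSections U T)
    (hU : ∀ x : N, ∃ i, x ∈ U i) {B : BanachManifold.{max uN uH, v} (TotalField H)}
    (hB : IsHilbertBundle E B U T) : S.GammaInfGlobal = smoothSecGlobal E B :=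
  Set.ext fun φ => (h.mem_gammaInfGlobal_iff hU φ).trans (hB.mem_smoothSecGlobal_iff hU φ).symm

/-- The section `T i ⁻¹ v` is infinitely differentiable on `U i`. Cut off near a point of the
overlap and extended by zero, it is so on `U j` by locality, and `T j` turns it into a smooth
function. -/
theorem TrivializesSections.stronglySmoothTransitions (h : S.TrivializesSections U T) :
    StronglySmoothTransitions E U T := by
  classical
  intro i j v x₀ hx₀
  refine ContMDiffAt.contMDiffWithinAt ?_
  let φ : ∀ x, H x := fun x => if hx : x ∈ U i then (T i ⟨x, hx⟩).symm v else 0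
  have hφ : ∀ x (hx : x ∈ U i), φ x = (T i ⟨x, hx⟩).symm v := fun x hx => dif_pos hx
  have hφi : ∀ n, φ ∈ S.DiffOn (U i) n := by
    refine (h.forall_diffOn_iff i φ).2 ((contMDiff_const (c := v)).congr fun x => ?_)
    rw [hφ x x.2]
    exact (T i x).apply_symm_apply v
  obtain ⟨f, hf, hfs, hf1⟩ := exists_smooth_bump (E := E) x₀
    (((U i).isOpen.inter (U j).isOpen).mem_nhds hx₀)
  let a : CFun E N := CFun.ofReal f hf
  have haf : ∀ x, a x = (f x : ℂ) := fun x => rfl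
  have hψ : ∀ n, (fun x => a x • φ x) ∈ S.DiffOn (U j) n := by
    intro n
    refine DiffOn.of_local (U j).isOpen fun x hx => ?_
    -- The support of the cut-off lies in `U i`; off this support the product is the zero section.
    by_cases hxs : x ∈ tsupport f
    · exact ⟨U i, (U i).isOpen, (hfs hxs).1, DiffOn.smul a (hφi n)⟩
    · refine ⟨(tsupport f)ᶜ, (isClosed_tsupport f).isOpen_compl, hxs,
        DiffOn.congr (DiffOn.of_mem _ n (0 : S.Γ)) (isClosed_tsupport f).isOpen_compl ?_⟩
      intro y hy
      have : f y = 0 := image_eq_zero_of_notMem_tsupport hy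
      rw [haf, this, Complex.ofReal_zero, zero_smul]
      rfl
  have h1 := (h.forall_diffOn_iff j _).1 hψ
  let g : N → F j := fun x => if hx : x ∈ U j then T j ⟨x, hx⟩ (a x • φ x) else 0
  have h2 : ContMDiffAt 𝓘(ℝ, E) 𝓘(ℝ, F j) ∞ g x₀ := by
    refine (contMDiffAt_subtype_iff (U := U j) (x := ⟨x₀, hx₀.2⟩)).1 ?_
    refine h1.contMDiffAt.congr_of_eventuallyEq (Eventually.of_forall fun x => ?_)
    exact dif_pos x.2
  refine h2.congr_of_eventuallyEq ?_
  filter_upwards [hf1, ((U i).isOpen.inter (U j).isOpen).mem_nhds hx₀] with x hx hxU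
  have h3 : g x = T j ⟨x, hxU.2⟩ (a x • φ x) := dif_pos hxU.2
  rw [h3, transition_apply hxU.1 hxU.2, haf, hx, Complex.ofReal_one, one_smul, hφ x hxU.1]

/-- Since `T i` is unitary, `h(φ,ψ)` is locally the inner product of two smooth functions with
values in the fixed space `F i`. -/
theorem TrivializesSections.contMDiff_herm (h : S.TrivializesSections U T)
    (hU : ∀ x : N, ∃ i, x ∈ U i) {φ ψ : ∀ x, H x} (hφ : φ ∈ S.GammaInfGlobal)
    (hψ : ψ ∈ S.GammaInfGlobal) : ContMDiff 𝓘(ℝ, E) 𝓘(ℝ, ℂ) ∞ (herm φ ψ) := by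
  intro x
  obtain ⟨i, hi⟩ := hU x
  refine (contMDiffAt_subtype_iff (U := U i) (x := ⟨x, hi⟩)).1 ?_
  have h1 := (h.mem_gammaInfGlobal_iff hU φ).1 hφ i
  have h2 := (h.mem_gammaInfGlobal_iff hU ψ).1 hψ i
  have h3 : ContDiff ℝ ∞ (fun p : F i × F i => (inner ℂ p.1 p.2 : ℂ)) := contDiff_inner
  have h4 := h3.comp_contMDiff (h2.prodMk_space h1)
  refine h4.contMDiffAt.congr_of_eventuallyEq (Eventually.of_forall fun y => ?_)
  exact ((T i y).inner_map_map _ _).symm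

/-- The connection extends to the infinitely differentiable sections, if the functions `h(φ,ψ)`
are smooth. -/
theorem exists_hermConn (hs : ∀ φ ∈ S.GammaInfGlobal, ∀ ψ ∈ S.GammaInfGlobal,
      ContMDiff 𝓘(ℝ, E) 𝓘(ℝ, ℂ) ∞ (herm φ ψ)) :
    ∃ (hΓ : (S.Γ : Set (∀ x, H x)) ⊆ S.GammaInfGlobal) (C : HermConn E H S.GammaInfGlobal),
      ∀ (X : CVect (E := E) (⊤ : Opens N)) (φ : S.Γ),
        (C.cov X ⟨φ.1, hΓ φ.2⟩).1 = (S.conn.cov X φ).1 := by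
  have hΓ : (S.Γ : Set (∀ x, H x)) ⊆ S.GammaInfGlobal := fun φ hφ =>
    (mem_gammaInfGlobal_iff φ).2 fun n => DiffOn.of_mem univ n ⟨φ, hφ⟩
  -- The limit derivatives define the connection. Uniqueness gives the Leibniz rule and agreement
  -- with the given connection; linearity in `X` passes to the limit along an approximating
  -- sequence.
  choose D hD hDn using fun φ : S.GammaInfGlobal =>
    exists_isCov_of_forall_diffOn isOpen_univ ((mem_gammaInfGlobal_iff φ.1).1 φ.2)
  have huniq : ∀ (φ : S.GammaInfGlobal) {D'}, S.IsCov univ φ.1 D' →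
      ∀ X x, D φ X x = D' X x := fun φ D' h' X x =>
    (hD φ).unique h' isOpen_univ isOpen_univ (mem_univ x) (mem_univ x)
      (Eventually.of_forall fun _ => rfl) X
  refine ⟨hΓ,
    { cov := fun X φ => ⟨D φ X, (mem_gammaInfGlobal_iff _).2 (hDn φ X)⟩
      cov_add := fun X Y φ x => ?_
      cov_smul := fun a X φ x => ?_
      leibniz := fun a X φ haφ x => huniq ⟨_, haφ⟩ ((hD φ).smul a) X x
      herm_smooth := fun φ ψ => hs φ.1 φ.2 ψ.1 ψ.2
      herm_deriv := fun X φ ψ x =>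
        ((hD φ).hermDeriv (hD ψ) isOpen_univ (mem_univ x)).2 X },
    fun X φ => funext fun x => huniq ⟨φ.1, hΓ φ.2⟩ (IsCov.of_mem univ φ) X x⟩
  · obtain ⟨s, h⟩ := hD φ
    have h := fun X => ((h x (mem_univ x)).2 X).tendsto
    refine tendsto_nhds_unique (h (X.add Y)) (((h X).add (h Y)).congr fun j => ?_)
    exact (S.conn.cov_add X Y (s j) x).symm
  · obtain ⟨s, h⟩ := hD φ
    have h := fun X => ((h x (mem_univ x)).2 X).tendsto
    refine tendsto_nhds_unique (h (X.smul a)) (((h X).const_smul (a x)).congr fun j => ?_)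
    exact (S.conn.cov_smul a X (s j) x).symm

end SmoothField

end SmoothFieldBundles

end

theorem theorem1p1
    {E : Type uE} [NormedAddCommGroup E] [NormedSpace ℝ E] [FiniteDimensional ℝ E]
    {N : Type uN} [TopologicalSpace N] [T2Space N] [SecondCountableTopology N]
    [ChartedSpace E N] [IsManifold 𝓘(ℝ, E) ∞ N]
    {H : N → Type uH} [∀ x, NormedAddCommGroup (H x)] [∀ x, InnerProductSpace ℂ (H x)]
    [∀ x, CompleteSpace (H x)]
    (S : SmoothField E H)
    {ι : Type uI} (U : ι → Opens N) (hU : ∀ x : N, ∃ i, x ∈ U i)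
    {F : ι → Type uF} [∀ i, NormedAddCommGroup (F i)] [∀ i, InnerProductSpace ℂ (F i)]
    [∀ i, CompleteSpace (F i)]
    (T : ∀ i, ∀ x : U i, H x ≃ₗᵢ[ℂ] F i) :
    ((∃ B : BanachManifold.{max uN uH, max uE uF} (TotalField H),
        IsHilbertBundle E B U T ∧
        (∀ i, smoothSec E B (U i) = S.GammaInf (U i)) ∧
        ∃ (hΓ : (S.Γ : Set (∀ x, H x)) ⊆ smoothSecGlobal E B)
          (C : HermConn E H (smoothSecGlobal E B)),
          ∀ (X : CVect (E := E) (⊤ : Opens N)) (φ : S.Γ),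
            (C.cov X ⟨φ.1, hΓ φ.2⟩).1 = (S.conn.cov X φ).1) ↔
      ∀ i, (fun (φ : ∀ x : U i, H x) (x : U i) => T i x (φ x)) '' S.GammaInf (U i) =
        {f : U i → F i | ContMDiff 𝓘(ℝ, E) 𝓘(ℝ, F i) ∞ f}) ∧
    ((∀ i, (fun (φ : ∀ x : U i, H x) (x : U i) => T i x (φ x)) '' S.GammaInf (U i) =
        {f : U i → F i | ContMDiff 𝓘(ℝ, E) 𝓘(ℝ, F i) ∞ f}) →
      ∀ B : BanachManifold.{max uN uH, max uE uF} (TotalField H), IsHilbertBundle E B U T →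
        S.GammaInfGlobal = smoothSecGlobal E B) := by
  refine ⟨⟨?_, fun hb => ?_⟩, ?_⟩
  · rintro ⟨B, hB, hsec, -⟩ i
    ext f
    constructor
    · rintro ⟨φ, hφ, rfl⟩
      rw [← hsec i] at hφ
      exact (hB.mem_smoothSec_iff i φ).1 hφ
    · intro hf
      have hf' : (fun x => T i x ((T i x).symm (f x))) = f :=
        funext fun x => (T i x).apply_symm_apply (f x)
      refine ⟨fun x => (T i x).symm (f x), ?_, hf'⟩
      rw [← hsec i, hB.mem_smoothSec_iff i, hf']
      exact hf
  · have h : S.TrivializesSections U T := hb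
    have hB := isHilbertBundle_bundleManifold hU h.stronglySmoothTransitions
    refine ⟨_, hB, fun i => Set.ext fun φ =>
      (hB.mem_smoothSec_iff i φ).trans (h.mem_gammaInf_iff i φ).symm, ?_⟩
    -- Once the smooth global sections are identified with `Γ^∞(N)`, the limit connection lives on
    -- the required space.
    rw [← h.gammaInfGlobal_eq hU hB]
    exact SmoothField.exists_hermConn fun φ hφ ψ hψ => h.contMDiff_herm hU hφ hψ
  · intro hb B hB
    exact SmoothField.TrivializesSections.gammaInfGlobal_eq hb hU hB
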